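/- **Construction.** Let $\mathbb N=\{1,2,\dots\}$. Define numbers $N_k,a_k,s_k,\epsilon_k,t_k,r_k,\delta_k$ ($k\in\mathbb N$) as follows. First, $N_1=2$, $4s_1+a_1=1$, $\epsilon_1=\frac{a_1}{100}=\frac{s_1}{10^5}$, and $t_1=\epsilon_1$, $r_1=s_1$, $\delta_1=a_1$. For $k\ge 2$ put $h_{k-1}=r_{k-1}-\frac{\delta_{k-1}}2$, $\hat\epsilon_{k-1}=t_{k-1}/h_{k-1}$, and $$N_k=2\Big\lceil\frac{100}{\hat\epsilon_{k-1}}\Big\rceil,\quad \frac{a_k}{s_k}=\frac1{\exp((2N_k)^{2k})},\quad N_ks_k+\Big(\frac{N_k}2-1\Big)a_k=1,\quad \epsilon_k=\min\Big\{\frac{\hat\epsilon_{k-1}}{100},\frac{a_k}{100}\Big\},$$ and $t_k=h_{k-1}\epsilon_k$, $r_k=h_{k-1}s_k$, $\delta_k=h_{k-1}a_k$. Let $\mathcal W_k$ be the set of pairs $w=(\tilde m,\tilde n)$ of words $\tilde m=m_1\cdots m_k$, $\tilde n=n_1\cdots n_k$ with $m_j\in\{\mathrm{Le},\mathrm{Ri}\}$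 and $n_j\in\{1,\dots,N_j\}$. Write $c_k(n)=s_k+(n-1)(2s_k+a_k)$. Put $x^{\mathrm{Le}}=-2$, $x^{\mathrm{Ri}}=2$, $y^{n_1}=c_1(n_1)$, and for $k\ge2$, $\tilde m\in\{\mathrm{Le},\mathrm{Ri}\}^{k-1}$ and $\tilde n=n_1\cdots n_{k-1}$, $$x^{\tilde m\,\mathrm{Le}}=x^{\tilde m}-\tfrac12t_{k-1},\qquad x^{\tilde m\,\mathrm{Ri}}=x^{\tilde m}+\tfrac12t_{k-1},$$ $$y^{\tilde n n_k}=\begin{cases}y^{\tilde n}-r_{k-1}+h_{k-1}c_k(n_k),& n_k\le N_k/2,\\ y^{\tilde n}+\frac{\delta_{k-1}}2+h_{k-1}c_k(n_k-N_k/2),& n_k>N_k/2.\end{cases}$$ For $w=(\tilde m,\tilde n)\in\mathcal W_k$ let $R^w=[x^{\tilde m}-t_k,x^{\tilde m}+t_k]\times[y^{\tilde n}-r_k,y^{\tilde n}+r_k]$, and let $D^w(\mathrm{Le})$, $D^w(\mathrm{Ri})$ be the closed disks of radius $r_k$ centered at $x^{\tilde m}-(2t_k+r_k)+iy^{\tilde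 n}$ and $x^{\tilde m}+(2t_k+r_k)+iy^{\tilde n}$, respectively. Let $$E\times F=\bigcap_{k\ge1}\bigcup_{w\in\mathcal W_k}R^w,\qquad \Omega=\hat{\mathbb C}\setminus\Big((E\times F)\cup\bigcup_{k\ge1}\bigcup_{w\in\mathcal W_k}\big(D^w(\mathrm{Le})\cup D^w(\mathrm{Ri})\big)\Big).$$ **Neighbors.** For $w=(\tilde m,\tilde n n_k)\in\mathcal W_k$ (here $\tilde n=n_1\cdots n_{k-1}$) and $l=\pm1$ put $w+l=(\tilde m,\tilde n(n_k+l))$. Call $w$ a bottom if $n_k\in\{1,\frac{N_k}2+1\}$ and a top if $n_k\in\{\frac{N_k}2,N_k\}$. Let $z\in E\times F$, $k\in\mathbb N$, and let $w\in\mathcal W_k$ be the element with $z\in R^w$. The $k$-th level neighbors $D_1,\dots,D_\ell$ of $z$ are, in this cyclic order ($D_{\ell+1}:=D_1$), * $D^{w-1}(\mathrm{Ri}),D^{w}(\mathrm{Ri}),D^{w+1}(\mathrm{Ri}),D^{w+1}(\mathrm{Le}),D^{w}(\mathrm{Le}),D^{w-1}(\mathrm{Le})$ if $w$ is neither a bottom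 nor a top, * $D^{w}(\mathrm{Ri}),D^{w+1}(\mathrm{Ri}),D^{w+1}(\mathrm{Le}),D^{w}(\mathrm{Le})$ if $w$ is a bottom, * $D^{w-1}(\mathrm{Ri}),D^{w}(\mathrm{Ri}),D^{w}(\mathrm{Le}),D^{w-1}(\mathrm{Le})$ if $w$ is a top. For $k=1$, where $N_1=2$ and every $w$ is both, the second list is used if $n_1=1$ and the third if $n_1=2$. **Paths.** A path $\gamma:[\alpha,\beta]\to\overline U$ (continuous, $\alpha<\beta$) connects $A_1$ and $A_2$ in $U\subset\mathbb C$ if $\gamma(\alpha)\in A_1$, $\gamma(\beta)\in A_2$ and $\gamma(t)\in U$ for $\alpha<t<\beta$; $|\gamma|$ is its image. The conformal modulus is $\operatorname{mod}(\Gamma)=\inf\int_{\mathbb C}\rho^2\,dA$ over Borel $\rho:\mathbb C\to[0,\infty]$ with $\int_\gamma\rho\,ds\ge1$ for all locally rectifiable $\gamma\in\Gamma$. A set $T\subset\mathbb C$ separates $z$ from $\infty$ if $z\notin T$ and $z,\infty$ lie in different connected components of $\hat{\mathbb C}\setminus T$. **Proposition.** For every $z\in E\times F$ and $k\in\mathbb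 N$, with $D_1,\dots,D_\ell$ the $k$-th level neighbors of $z$, there are families $\Gamma_j$, $j\in\{1,\dots,\ell\}$, of paths connecting $D_j$ and $D_{j+1}$ in $\Omega\setminus\{\infty\}$ such that 1. $\operatorname{mod}(\Gamma_j)\ge\frac1{10}$ for every $j\in\{1,\dots,\ell\}$, and 2. if $\gamma_j\in\Gamma_j$ for every $j\in\{1,\dots,\ell\}$, then $\bigcup_{j=1}^\ell(|\gamma_j|\cup D_j)$ separates $z$ from $\infty$. -/

import Mathlib

open MeasureTheory Set
open scoped ENNReal

noncomputable section

/-! ### Paths, conformal modulus, separation -/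

/-- A path in the plane: a continuous map from a compact interval `[α, β]`, `α < β`, to `ℂ`
(the values of `toFun` outside `[α, β]` are never used). -/
structure PlanePath where
  α : ℝ
  β : ℝ
  lt : α < β
  toFun : ℝ → ℂ
  cont : ContinuousOn toFun (Icc α β)

/-- The image `|γ|` of a path. -/
def PlanePath.trace (γ : PlanePath) : Set ℂ := γ.toFun '' Icc γ.α γ.β

/-- `γ` connects `A₁` and `A₂` in `U`: it is a path in the closure of `U` that starts in `A₁`, ends
in `A₂`, and runs in `U` at all interior times. -/
def PlanePath.Connects (γ : PlanePath) (A₁ A₂ U : Set ℂ) : Prop :=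
  MapsTo γ.toFun (Icc γ.α γ.β) (closure U) ∧ γ.toFun γ.α ∈ A₁ ∧ γ.toFun γ.β ∈ A₂ ∧
    ∀ t ∈ Ioo γ.α γ.β, γ.toFun t ∈ U

/-- Local rectifiability (for a path on a compact interval this is rectifiability). -/
def PlanePath.LocallyRectifiable (γ : PlanePath) : Prop :=
  LocallyBoundedVariationOn γ.toFun (Icc γ.α γ.β)

/-- The length of a path. -/
def PlanePath.length (γ : PlanePath) : ℝ≥0∞ := eVariationOn γ.toFun (Icc γ.α γ.β)

/-- The integral `∫_γ ρ ds` of `ρ` along a rectifiable path `γ`: the integral of `ρ` along the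
arc-length parametrization of `γ` over `[0, length γ]`. -/
def PlanePath.lineIntegral (γ : PlanePath) (ρ : ℂ → ℝ≥0∞) : ℝ≥0∞ :=
  ∫⁻ u in Icc 0 γ.length.toReal, ρ (naturalParameterization γ.toFun (Icc γ.α γ.β) γ.α u)

/-- Admissible functions of a path family. -/
def Admissible (Γ : Set PlanePath) (ρ : ℂ → ℝ≥0∞) : Prop :=
  Measurable ρ ∧ ∀ γ ∈ Γ, γ.LocallyRectifiable → 1 ≤ γ.lineIntegral ρ

/-- The conformal modulus of a path family: the infimum of `∫ ρ² dA` over admissible `ρ`. -/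
def conformalModulus (Γ : Set PlanePath) : ℝ≥0∞ :=
  ⨅ (ρ : ℂ → ℝ≥0∞) (_ : Admissible Γ ρ), ∫⁻ z, ρ z ^ 2

/-- `T` separates `p` from `q` in the space `X`: the two points lie off `T`, in different connected
components of the complement of `T`. -/
def Separates {X : Type*} [TopologicalSpace X] (T : Set X) (p q : X) : Prop :=
  p ∈ Tᶜ ∧ q ∈ Tᶜ ∧ connectedComponentIn Tᶜ p ≠ connectedComponentIn Tᶜ q

/-! ### Parameters of the construction -/

/-- Half of the common length `2s` of the `M` closed segments that remain when `M - 1` open segments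
of length `a` are removed from `[0, 1]`, where `a = q * s`; that is, `2 M s + (M - 1) q s = 1`. -/
def blockHalfLength (M : ℤ) (q : ℝ) : ℝ := 1 / (2 * (M : ℝ) + ((M : ℝ) - 1) * q)

/-- The parameters of one level: the number `N` of letters and the lengths `a, s, ε` of
the (normalized) building block, and the true half-width `t` and half-height `r` of the rectangles of
this level (`r` is also the radius of the disks) and the true length `δ` of the gaps. -/
structure Level where
  N : ℤ
  a : ℝ
  s : ℝ
  ε : ℝ
  t : ℝ
  r : ℝ
  δ : ℝ

/-- The length of each of the two segments left after removing the middle gap of length `δ` from a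
vertical side of length `2r`. -/
def Level.halfSide (p : Level) : ℝ := p.r - p.δ / 2

/-- The relative half-width (written ε with a hat) of the rectangles of a level: the half-width
after the rescaling that turns `halfSide` into `1`. -/
def Level.relWidth (p : Level) : ℝ := p.t / p.halfSide

/-- Level one: `N = 2`, `ε = a / 100 = s / 10 ^ 5`. -/
def firstLevel : Level :=
  let s := blockHalfLength 2 (1 / 1000)
  let a := s / 1000
  let ε := a / 100
  ⟨2, a, s, ε, ε, s, a⟩

/-- The parameters of level `k ≥ 2`, given the parameters `p` of level `k - 1`. The building block
with `N / 2` segments is scaled by the factor `p.halfSide`. -/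
def nextLevel (k : ℕ) (p : Level) : Level :=
  let N : ℤ := 2 * ⌈100 / p.relWidth⌉
  let q : ℝ := 1 / Real.exp ((2 * (N : ℝ)) ^ (2 * k))
  let s := blockHalfLength (N / 2) q
  let a := q * s
  let ε := min (p.relWidth / 100) (a / 100)
  ⟨N, a, s, ε, p.halfSide * ε, p.halfSide * s, p.halfSide * a⟩

/-- The parameters of level `k ≥ 1` (the value at `0` is not used). -/
def level : ℕ → Level
  | 0 => firstLevel
  | 1 => firstLevel
  | k + 2 => nextLevel (k + 2) (level (k + 1))

/-! ### Words, rectangles, disks -/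

inductive Side
  | Le
  | Ri

def Side.sign : Side → ℝ
  | Le => -1
  | Ri => 1

/-- A pair of words `(m₁ ⋯ mₖ, n₁ ⋯ nₖ)`, `k ≥ 1`. The last letters `mₖ` and `nₖ` are the fields `m`
and `n`, the initial words are the fields `mInit` and `nInit`, stored as lists from the last letter
to the first. -/
structure Word where
  mInit : List Side
  m : Side
  nInit : List ℤ
  n : ℤ

/-- Words `n₁ ⋯ nₖ` with `1 ≤ n_j ≤ N_j` (listed from the last letter to the first). -/
def nWords : ℕ → Set (List ℤ)
  | 0 => {[]}
  | k + 1 => {l | ∃ n l', l = n :: l' ∧ l' ∈ nWords k ∧ 1 ≤ n ∧ n ≤ (level (k + 1)).N}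

/-- The set `𝒲ₖ` of pairs of words of length `k` (empty for `k = 0`). -/
def wordsOfLength (k : ℕ) : Set Word :=
  {w | (w.m :: w.mInit).length = k ∧ w.n :: w.nInit ∈ nWords k}

/-- The word `w + l`: the last letter `nₖ` is changed to `nₖ + l`. -/
def Word.shift (w : Word) (l : ℤ) : Word := { w with n := w.n + l }

/-- The midpoint of the `n`-th closed segment (`n = 1, 2, …`) of the building block. -/
def Level.blockCenter (p : Level) (n : ℤ) : ℝ := p.s + ((n : ℝ) - 1) * (2 * p.s + p.a)

/-- The first coordinate of the center of the rectangle: `∓2` at level one; afterwards the normalized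
shift `∓ relWidth / 2`, scaled by `halfSide`, is added to the coordinate of the parent. -/
def xCoord : List Side → Side → ℝ
  | [], m => 2 * m.sign
  | m' :: l, m =>
      let p := level (l.length + 1)
      xCoord l m' + p.halfSide * (m.sign * (p.relWidth / 2))

/-- The second coordinate of the center of the rectangle. At level one it is read off
the building block. Afterwards the letters `1, …, N / 2` belong to the copy of the building block over
the lower segment `[y - r, y - δ / 2]` of the parent, and `N / 2 + 1, …, N` to the copy over the upper
segment `[y + δ / 2, y + r]`. -/
def yCoord : List ℤ → ℤ → ℝ
  | [], n => (level 1).blockCenter n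
  | n' :: l, n =>
      let p := level (l.length + 1)
      let q := level (l.length + 2)
      if n ≤ q.N / 2 then
        (yCoord l n' - p.r) + p.halfSide * q.blockCenter n
      else
        (yCoord l n' + p.δ / 2) + p.halfSide * q.blockCenter (n - q.N / 2)

def Word.x (w : Word) : ℝ := xCoord w.mInit w.m

def Word.y (w : Word) : ℝ := yCoord w.nInit w.n

/-- The closed rectangle `R^w`, for `w` of length `k`. -/
def rect (k : ℕ) (w : Word) : Set ℂ :=
  Icc (w.x - (level k).t) (w.x + (level k).t) ×ℂ Icc (w.y - (level k).r) (w.y + (level k).r)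

/-- The closed disk `D^w(Le)` or `D^w(Ri)`, for `w` of length `k`. -/
def disk (k : ℕ) (w : Word) (e : Side) : Set ℂ :=
  Metric.closedBall (⟨w.x + e.sign * (2 * (level k).t + (level k).r), w.y⟩ : ℂ) (level k).r

/-- The set `E × F`: the intersection over `k ≥ 1` of the unions of the rectangles of level `k`. -/
def cantorProduct : Set ℂ := ⋂ k ∈ Ici 1, ⋃ w ∈ wordsOfLength k, rect k w

/-- The union of all disks `D^w(Le)` and `D^w(Ri)`, over words `w` of all lengths. -/
def allDisks : Set ℂ := ⋃ k ∈ Ici 1, ⋃ w ∈ wordsOfLength k, disk k w Side.Le ∪ disk k w Side.Ri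

/-- The circle domain `Ω` in the Riemann sphere. -/
def Omega : Set (OnePoint ℂ) := ((↑) '' (allDisks ∪ cantorProduct))ᶜ

/-- `Ω` without the point at infinity, as a subset of the plane. -/
def OmegaFinite : Set ℂ := (↑) ⁻¹' Omega

/-! ### Neighbors -/

/-- `w`, of length `k`, is a bottom. -/
def Word.IsBottom (w : Word) (k : ℕ) : Prop := w.n = 1 ∨ w.n = (level k).N / 2 + 1

/-- `w`, of length `k`, is a top. -/
def Word.IsTop (w : Word) (k : ℕ) : Prop := w.n = (level k).N / 2 ∨ w.n = (level k).N

open Classical in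
/-- The ordered list of the neighbors of a rectangle of level `k`. The inequality in the second case
matters only for `k = 1`, where `N = 2` and both letters are bottoms as well as tops: then the
list is the one of the two which involves existing disks only. -/
def neighbors (k : ℕ) (w : Word) : List (Set ℂ) :=
  if ¬ w.IsBottom k ∧ ¬ w.IsTop k then
    [disk k (w.shift (-1)) .Ri, disk k w .Ri, disk k (w.shift 1) .Ri,
      disk k (w.shift 1) .Le, disk k w .Le, disk k (w.shift (-1)) .Le]
  else if w.IsBottom k ∧ w.n + 1 ≤ (level k).N then
    [disk k w .Ri, disk k (w.shift 1) .Ri, disk k (w.shift 1) .Le, disk k w .Le]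
  else
    [disk k (w.shift (-1)) .Ri, disk k w .Ri, disk k w .Le, disk k (w.shift (-1)) .Le]

end

/-! ### Line integrals along Lipschitz paths and a length-area estimate -/

/-! The curves that surround `z` are built from three kinds of crossings between consecutive
neighbors: horizontal segments through the middle gap of a rectangle, vertical segments through the
gap between two consecutive disks of a column, and, at a bottom or a top, V-shaped curves that pass
beyond the rectangle itself. In each case the available curves are translates of one graph of slope
0 or ±1, and they sweep out a strip whose width is comparable to its length.

Modulus. Let the graphs of `s ↦ κ|s| + c` over an interval of length ℓ be indexed by an interval of
`c` of length d. Cauchy–Schwarz on each curve and integration over `c` (Fubini; shear and isometry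
preserve area) give modulus at least d / ((1 + κ²)ℓ). Passing to subarcs only helps. For the three
kinds this ratio is about 1/4, 1/3 and 9/40, which exceeds 1/10
(`le_conformalModulus_of_graphCurve`, `hasCrossing_gap`, `hasCrossing_side`, `hasCrossing_wedge`).

Obstacles. The scales satisfy 200 r_{k+1} ≤ t_k, 100 t_k ≤ δ_k and 1000 δ_k ≤ r_k. Hence the disks
of levels below k stay at distance 4 r_k from the axis of any column of level k, other columns are
10 r_k away, and everything of a deeper level, as well as E × F, lies in the rectangles of level k
with their middle gaps removed. Near a column only its own disks and these half rectangles can be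
hit (`exists_of_mem_obstacle`), and heights decide which ones.

Separation. With the disks added, the chosen crossings contain the frontier of a bounded region
around `z`: a graph below, a graph above, and on each side a vertical line. The vertical segments
below and above the disk of `w` are chosen independently, so the line may jump, but it does so near
the center of that disk (`separates_of_barriers`, `separates_of_endBarriers`). -/

theorem restrict_image_le_smul_map {V : ℝ → ℝ} {L : NNReal} {X : Set ℝ} (hX : MeasurableSet X)
    (hV : LipschitzOnWith L V X) :
    (volume : Measure ℝ).restrict (V '' X) ≤
      (L : ℝ≥0∞) • Measure.map V ((volume : Measure ℝ).restrict X) := by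
  refine Measure.le_iff.2 fun B hB => ?_
  have hm : AEMeasurable V (volume.restrict X) := hV.continuousOn.aemeasurable hX
  rw [Measure.restrict_apply hB, Measure.smul_apply, Measure.map_apply_of_aemeasurable hm hB,
    Measure.restrict_apply₀ (hm.nullMeasurableSet_preimage hB), smul_eq_mul]
  have h1 : B ∩ V '' X ⊆ V '' (V ⁻¹' B ∩ X) := by
    rintro _ ⟨hb, x, hx, rfl⟩
    exact ⟨x, ⟨hb, hx⟩, rfl⟩
  have h2 := (hV.mono (inter_subset_right (s := V ⁻¹' B))).hausdorffMeasure_image_le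
    (d := 1) zero_le_one
  rw [hausdorffMeasure_real, ENNReal.rpow_one] at h2
  exact (measure_mono h1).trans h2

theorem variationOnFromTo_lipschitzOnWith {f : ℝ → ℂ} {L : NNReal} {α β : ℝ}
    (h : LipschitzOnWith L f (Icc α β)) (hαβ : α ≤ β) :
    LipschitzOnWith L (variationOnFromTo f (Icc α β) α) (Icc α β) := by
  have hl := h.locallyBoundedVariationOn
  have key : ∀ x ∈ Icc α β, ∀ y ∈ Icc α β, x ≤ y →
      variationOnFromTo f (Icc α β) α y - variationOnFromTo f (Icc α β) α x ≤ L * (y - x) := by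
    intro x hx y hy hxy
    have h1 := variationOnFromTo.add hl (left_mem_Icc.2 hαβ) hx hy
    have h2 : variationOnFromTo f (Icc α β) x y ≤ L * (y - x) := by
      rw [variationOnFromTo.eq_of_le _ _ hxy]
      -- The variation of the path is at most `L` times that of the identity, which is `y - x`.
      have h3 := h.comp_eVariationOn_le (g := id) (s := Icc α β ∩ Icc x y)
        (fun z hz => hz.1)
      rw [(monotoneOn_id (s := Icc α β)).eVariationOn_eq hx hy] at h3
      refine ENNReal.toReal_le_of_le_ofReal (mul_nonneg L.2 (sub_nonneg.2 hxy)) ?_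
      rw [ENNReal.ofReal_mul L.coe_nonneg, ENNReal.ofReal_coe_nnreal]
      exact h3
    linarith
  have hmono := variationOnFromTo.monotoneOn hl (left_mem_Icc.2 hαβ)
  refine LipschitzOnWith.of_dist_le_mul fun x hx y hy => ?_
  rw [Real.dist_eq, Real.dist_eq]
  rcases le_total x y with hxy | hxy
  · have := key x hx y hy hxy
    have := hmono hx hy hxy
    rw [abs_sub_comm, abs_of_nonneg (by linarith), abs_sub_comm, abs_of_nonneg (by linarith)]
    linarith
  · have := key y hy x hx hxy
    have := hmono hy hx hxy
    rw [abs_of_nonneg (by linarith), abs_of_nonneg (by linarith)]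
    linarith

/-- The arc-length function is `L`-Lipschitz and maps `[α, β]` onto `[0, length]`. Lebesgue measure
on its image is therefore at most `L` times the pushforward of Lebesgue measure. An upper bound
suffices for the modulus, so the speed of the path is never computed. -/
theorem PlanePath.lineIntegral_le (γ : PlanePath) {L : NNReal}
    (h : LipschitzOnWith L γ.toFun (Icc γ.α γ.β)) (ρ : ℂ → ℝ≥0∞) :
    γ.lineIntegral ρ ≤ L * ∫⁻ s in Icc γ.α γ.β, ρ (γ.toFun s) := by
  have hle := γ.lt.le
  have hl := h.locallyBoundedVariationOn
  have hV := variationOnFromTo_lipschitzOnWith h hle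
  set V := variationOnFromTo γ.toFun (Icc γ.α γ.β) γ.α with hVdef
  have hα : γ.α ∈ Icc γ.α γ.β := left_mem_Icc.2 hle
  have hsub : Icc 0 γ.length.toReal ⊆ V '' Icc γ.α γ.β := by
    have h1 := intermediate_value_Icc hle hV.continuousOn
    have h2 : V γ.α = 0 := variationOnFromTo.self _ _ _
    have h3 : V γ.β = γ.length.toReal := by
      rw [hVdef, variationOnFromTo.eq_of_le _ _ hle, inter_self]
      rfl
    rwa [h2, h3] at h1
  calc γ.lineIntegral ρ
      ≤ ∫⁻ u in V '' Icc γ.α γ.β,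
          ρ (naturalParameterization γ.toFun (Icc γ.α γ.β) γ.α u) :=
        lintegral_mono_set hsub
    _ ≤ ∫⁻ u, ρ (naturalParameterization γ.toFun (Icc γ.α γ.β) γ.α u)
          ∂((L : ℝ≥0∞) • Measure.map V (volume.restrict (Icc γ.α γ.β))) :=
        lintegral_mono' (restrict_image_le_smul_map measurableSet_Icc hV) le_rfl
    _ = L * ∫⁻ u, ρ (naturalParameterization γ.toFun (Icc γ.α γ.β) γ.α u)
          ∂(Measure.map V (volume.restrict (Icc γ.α γ.β))) := by
        rw [lintegral_smul_measure, smul_eq_mul]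
    _ ≤ L * ∫⁻ s in Icc γ.α γ.β,
          ρ (naturalParameterization γ.toFun (Icc γ.α γ.β) γ.α (V s)) := by
        exact mul_le_mul' le_rfl (lintegral_map_le _ _)
    _ = L * ∫⁻ s in Icc γ.α γ.β, ρ (γ.toFun s) := by
        congr 1
        refine setLIntegral_congr_fun measurableSet_Icc fun s hs => ?_
        have := edist_naturalParameterization_eq_zero hl hα hs
        rw [edist_eq_zero] at this
        simp only [hVdef, this]

/-- The graph of `s ↦ κ|s| + c`, moved by the affine map `w ↦ z₀ + e w`. -/
def graphCurve (z₀ e : ℂ) (κ c s : ℝ) : ℂ :=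
  z₀ + e * ((s : ℂ) + Complex.I * ((κ * |s| + c : ℝ) : ℂ))

theorem graphCurve_eq_mk (z₀ e : ℂ) (κ c s : ℝ) :
    graphCurve z₀ e κ c s = z₀ + e * (⟨s, κ * |s| + c⟩ : ℂ) := by
  unfold graphCurve
  congr 2
  apply Complex.ext <;> simp

theorem continuous_graphCurve (z₀ e : ℂ) (κ c : ℝ) : Continuous (graphCurve z₀ e κ c) := by
  unfold graphCurve
  fun_prop

theorem lipschitzWith_graphCurve {z₀ e : ℂ} (he : ‖e‖ = 1) (κ c : ℝ) :
    LipschitzWith (NNReal.sqrt (1 + ⟨κ ^ 2, sq_nonneg κ⟩)) (graphCurve z₀ e κ c) := by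
  refine LipschitzWith.of_dist_le_mul fun x y => ?_
  rw [graphCurve_eq_mk, graphCurve_eq_mk, dist_add_left, dist_eq_norm, ← mul_sub, norm_mul, he,
    one_mul, Complex.norm_eq_sqrt_sq_add_sq, Real.dist_eq]
  have h1 : ((NNReal.sqrt (1 + ⟨κ ^ 2, sq_nonneg κ⟩) : NNReal) : ℝ) = √(1 + κ ^ 2) := by
    rw [Real.coe_sqrt]
    rfl
  rw [h1, ← Real.sqrt_sq_eq_abs (x - y), ← Real.sqrt_mul (by positivity)]
  refine Real.sqrt_le_sqrt ?_
  have h2 : (|x| - |y|) ^ 2 ≤ (x - y) ^ 2 := sq_le_sq.2 (abs_abs_sub_abs_le_abs_sub x y)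
  simp only [Complex.sub_re, Complex.sub_im]
  nlinarith [mul_le_mul_of_nonneg_left h2 (sq_nonneg κ)]

/-- The map `(c, s) ↦ graphCurve z₀ e κ c s` is a vertical shear followed by a rotation and a
translation, so its Jacobian is 1. -/
theorem lintegral_lintegral_graphCurve {z₀ e : ℂ} (he : ‖e‖ = 1) (κ : ℝ) {G : ℂ → ℝ≥0∞}
    (hG : Measurable G) :
    ∫⁻ c : ℝ, ∫⁻ s : ℝ, G (graphCurve z₀ e κ c s) = ∫⁻ z, G z := by
  have hmeas : Measurable fun p : ℝ × ℝ => G (graphCurve z₀ e κ p.1 p.2) := by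
    refine hG.comp (Continuous.measurable ?_)
    unfold graphCurve
    fun_prop
  rw [lintegral_lintegral_swap hmeas.aemeasurable]
  have h1 : ∀ s : ℝ, ∫⁻ c : ℝ, G (graphCurve z₀ e κ c s) =
      ∫⁻ c : ℝ, G (z₀ + e * (⟨s, c⟩ : ℂ)) := fun s => by
    simp only [graphCurve_eq_mk]
    -- For fixed `s` the term `κ|s|` is a translation in `c`.
    exact lintegral_add_left_eq_self (μ := volume) (fun c : ℝ => G (z₀ + e * (⟨s, c⟩ : ℂ))) _
  simp only [h1]
  have hrot : MeasurePreserving (fun w : ℂ => z₀ + e * w) volume volume := by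
    have h2 := (rotation ⟨e, mem_sphere_zero_iff_norm.2 he⟩).measurePreserving
    exact (measurePreserving_add_left volume z₀).comp h2
  rw [← hrot.lintegral_comp hG]
  have hG' : Measurable fun w : ℂ => G (z₀ + e * w) := hG.comp hrot.measurable
  rw [← Complex.volume_preserving_equiv_real_prod.symm.lintegral_comp hG',
    Measure.volume_eq_prod]
  exact (lintegral_prod _
      (hG'.comp Complex.measurableEquivRealProd.symm.measurable).aemeasurable).symm

theorem sq_lintegral_le_measure_mul_lintegral_sq {X : Type*} [MeasurableSpace X] (μ : Measure X)
    {f : X → ℝ≥0∞} (hf : AEMeasurable f μ) :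
    (∫⁻ x, f x ∂μ) ^ 2 ≤ μ univ * ∫⁻ x, f x ^ 2 ∂μ := by
  have h := ENNReal.lintegral_mul_le_Lp_mul_Lq μ Real.HolderConjugate.two_two
    (aemeasurable_const (b := (1 : ℝ≥0∞))) hf
  simp only [Pi.mul_apply, one_mul, ENNReal.rpow_two, one_pow, lintegral_one] at h
  calc (∫⁻ x, f x ∂μ) ^ 2
      ≤ (μ univ ^ (1 / 2 : ℝ) * (∫⁻ x, f x ^ 2 ∂μ) ^ (1 / 2 : ℝ)) ^ 2 := by gcongr
    _ = μ univ * ∫⁻ x, f x ^ 2 ∂μ := by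
        rw [mul_pow, ← ENNReal.rpow_two, ← ENNReal.rpow_two, ← ENNReal.rpow_mul,
          ← ENNReal.rpow_mul]
        norm_num

/-- Length-area estimate: a family of paths which contains a subarc of each of the curves
`graphCurve z₀ e κ c`, restricted to `[p, q]`, for `c ∈ [c₁, c₂]`. -/
theorem le_conformalModulus_of_graphCurve {Γ : Set PlanePath} {z₀ e : ℂ} (he : ‖e‖ = 1)
    {κ p q c₁ c₂ m : ℝ} (hpq : p < q)
    (h : ∀ c ∈ Icc c₁ c₂, ∃ γ ∈ Γ, γ.toFun = graphCurve z₀ e κ c ∧ p ≤ γ.α ∧ γ.β ≤ q)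
    (hm : m * ((1 + κ ^ 2) * (q - p)) ≤ c₂ - c₁) :
    ENNReal.ofReal m ≤ conformalModulus Γ := by
  refine le_iInf₂ fun ρ hρ => ?_
  set L : NNReal := NNReal.sqrt (1 + ⟨κ ^ 2, sq_nonneg κ⟩) with hL
  have hL2 : ((L : ℝ≥0∞)) ^ 2 = ENNReal.ofReal (1 + κ ^ 2) := by
    rw [← ENNReal.coe_pow, hL, NNReal.sq_sqrt, ENNReal.ofReal]
    congr 1
    apply NNReal.eq
    rw [Real.coe_toNNReal _ (by positivity)]
    rfl
  have hK : 0 < (1 + κ ^ 2) * (q - p) := mul_pos (by positivity) (by linarith)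
  -- Admissibility on one curve, squared: Cauchy–Schwarz contributes the parameter length `q - p`,
  -- and the Lipschitz constant contributes `L² = 1 + κ²`.
  have hline : ∀ c ∈ Icc c₁ c₂,
      1 ≤ ENNReal.ofReal ((1 + κ ^ 2) * (q - p)) *
        ∫⁻ s, ρ (graphCurve z₀ e κ c s) ^ 2 := by
    intro c hc
    obtain ⟨γ, hγ, hfun, hα, hβ⟩ := h c hc
    have hlip : LipschitzOnWith L γ.toFun (Icc γ.α γ.β) := by
      rw [hfun]
      exact (lipschitzWith_graphCurve he κ c).lipschitzOnWith
    have h1 := (hρ.2 γ hγ hlip.locallyBoundedVariationOn).trans (γ.lineIntegral_le hlip ρ)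
    have hmeas : Measurable fun s => ρ (graphCurve z₀ e κ c s) :=
      hρ.1.comp (continuous_graphCurve z₀ e κ c).measurable
    calc (1 : ℝ≥0∞) = 1 ^ 2 := (one_pow 2).symm
      _ ≤ (L * ∫⁻ s in Icc γ.α γ.β, ρ (γ.toFun s)) ^ 2 := by gcongr
      _ ≤ (L * ∫⁻ s in Icc p q, ρ (graphCurve z₀ e κ c s)) ^ 2 := by
          rw [hfun]
          gcongr
      _ ≤ (L : ℝ≥0∞) ^ 2 * (ENNReal.ofReal (q - p) *
            ∫⁻ s in Icc p q, ρ (graphCurve z₀ e κ c s) ^ 2) := by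
          rw [mul_pow]
          gcongr
          refine (sq_lintegral_le_measure_mul_lintegral_sq _ hmeas.aemeasurable).trans ?_
          rw [Measure.restrict_apply_univ, Real.volume_Icc]
      _ ≤ (L : ℝ≥0∞) ^ 2 * (ENNReal.ofReal (q - p) *
            ∫⁻ s, ρ (graphCurve z₀ e κ c s) ^ 2) := by
          gcongr
          exact Measure.restrict_le_self
      _ = _ := by
          rw [hL2, ENNReal.ofReal_mul (by positivity), mul_assoc]
  have hsq : Measurable fun z => ρ z ^ 2 := hρ.1.pow_const 2
  have htotal : ENNReal.ofReal (c₂ - c₁) ≤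
      ENNReal.ofReal ((1 + κ ^ 2) * (q - p)) * ∫⁻ z, ρ z ^ 2 :=
    calc ENNReal.ofReal (c₂ - c₁) = ∫⁻ _ in Icc c₁ c₂, 1 := by
          rw [setLIntegral_one, Real.volume_Icc]
      _ ≤ ∫⁻ c in Icc c₁ c₂, ENNReal.ofReal ((1 + κ ^ 2) * (q - p)) *
            ∫⁻ s, ρ (graphCurve z₀ e κ c s) ^ 2 :=
          setLIntegral_mono' measurableSet_Icc hline
      _ ≤ ∫⁻ c, ENNReal.ofReal ((1 + κ ^ 2) * (q - p)) *
            ∫⁻ s, ρ (graphCurve z₀ e κ c s) ^ 2 := setLIntegral_le_lintegral _ _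
      _ = _ := by
          rw [lintegral_const_mul' _ _ ENNReal.ofReal_ne_top,
            lintegral_lintegral_graphCurve he κ hsq]
  have h2 : ENNReal.ofReal ((1 + κ ^ 2) * (q - p)) * ENNReal.ofReal m ≤
      ENNReal.ofReal ((1 + κ ^ 2) * (q - p)) * ∫⁻ z, ρ z ^ 2 := by
    refine le_trans ?_ htotal
    rw [← ENNReal.ofReal_mul hK.le, mul_comm]
    exact ENNReal.ofReal_le_ofReal hm
  exact (ENNReal.mul_le_mul_iff_right (by simpa using hK) ENNReal.ofReal_ne_top).1 h2

/-- If a curve runs from `A` to `B`, meets `A` only in an initial and `B` only in a final interval,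
and is in `U` in between, then its part from the last point in `A` to the first point in `B`
connects `A` and `B` in `U`. -/
theorem exists_connects_subarc {σ : ℝ → ℂ} (hσ : Continuous σ) {p q : ℝ} (hpq : p ≤ q)
    {A B U : Set ℂ} (hA : IsClosed A) (hB : IsClosed B) (hAB : Disjoint A B)
    (hp : σ p ∈ A) (hq : σ q ∈ B) (hU : ∀ s ∈ Icc p q, σ s ∈ A ∪ B ∪ U)
    (hAi : ∀ s ∈ Icc p q, σ s ∈ A → ∀ s' ∈ Icc p s, σ s' ∈ A)
    (hBi : ∀ s ∈ Icc p q, σ s ∈ B → ∀ s' ∈ Icc s q, σ s' ∈ B) :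
    ∃ γ : PlanePath, γ.toFun = σ ∧ p ≤ γ.α ∧ γ.β ≤ q ∧ γ.Connects A B U ∧
      σ '' Icc p q ⊆ γ.trace ∪ A ∪ B := by
  have hcA : IsCompact (Icc p q ∩ σ ⁻¹' A) := isCompact_Icc.inter_right (hA.preimage hσ)
  have hcB : IsCompact (Icc p q ∩ σ ⁻¹' B) := isCompact_Icc.inter_right (hB.preimage hσ)
  obtain ⟨a, ⟨ha, haA⟩, hamax⟩ := hcA.exists_isGreatest ⟨p, left_mem_Icc.2 hpq, hp⟩
  obtain ⟨b, ⟨hb, hbB⟩, hbmin⟩ := hcB.exists_isLeast ⟨q, right_mem_Icc.2 hpq, hq⟩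
  have hab : a < b := by
    by_contra! hcon
    exact disjoint_left.1 hAB (hAi a ha haA b ⟨hb.1, hcon⟩) hbB
  have hmid : ∀ t ∈ Ioo a b, σ t ∈ U := by
    intro t ht
    have htI : t ∈ Icc p q := ⟨ha.1.trans ht.1.le, ht.2.le.trans hb.2⟩
    rcases hU t htI with (h | h) | h
    · exact absurd (hamax ⟨htI, h⟩) (not_le.2 ht.1)
    · exact absurd (hbmin ⟨htI, h⟩) (not_le.2 ht.2)
    · exact h
  refine ⟨⟨a, b, hab, σ, hσ.continuousOn⟩, rfl, ha.1, hb.2, ⟨?_, haA, hbB, hmid⟩, ?_⟩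
  · intro t ht
    have h1 : t ∈ closure (Ioo a b) := by rwa [closure_Ioo hab.ne]
    exact map_mem_closure hσ h1 hmid
  · rintro _ ⟨s, hs, rfl⟩
    rcases le_or_gt s a with h | h
    · exact Or.inl (Or.inr (hAi a ha haA s ⟨hs.1, h⟩))
    rcases le_or_gt b s with h' | h'
    · exact Or.inr (hBi b hb hbB s ⟨h', hs.2⟩)
    · exact Or.inl (Or.inl ⟨s, ⟨h.le, h'.le⟩, rfl⟩)

/-- The paths that connect `A` and `B` in `U` and together with `A` and `B` cover one of the sets
in `𝒮`. -/
def crossingFamily (A B U : Set ℂ) (𝒮 : Set (Set ℂ)) : Set PlanePath :=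
  {γ | γ.Connects A B U ∧ ∃ S ∈ 𝒮, S ⊆ γ.trace ∪ A ∪ B}

/-- The curve is straight on each side of its corner at `s = 0`; the condition `0 ≤ a * b` keeps
both parameters on one side. -/
theorem graphCurve_mem_of_convex {z₀ e : ℂ} {κ c : ℝ} {A : Set ℂ} (hA : Convex ℝ A) {a b : ℝ}
    (hab : 0 ≤ a * b) (ha : graphCurve z₀ e κ c a ∈ A) (hb : graphCurve z₀ e κ c b ∈ A) {s : ℝ}
    (hs : s ∈ Icc a b) : graphCurve z₀ e κ c s ∈ A := by
  obtain ⟨x, y, hx, hy, hxy, rfl⟩ := (Convex.mem_Icc (hs.1.trans hs.2)).1 hs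
  have habs : |x * a + y * b| = x * |a| + y * |b| := by
    rcases le_or_gt 0 a with h | h <;> rcases le_or_gt 0 b with h' | h'
    · rw [abs_of_nonneg h, abs_of_nonneg h', abs_of_nonneg (by positivity)]
    · have : a = 0 := by nlinarith
      subst this
      simp [abs_mul, abs_of_nonneg hy]
    · have : b = 0 := by nlinarith
      subst this
      simp [abs_mul, abs_of_nonneg hx]
    · rw [abs_of_neg h, abs_of_neg h', abs_of_nonpos (by nlinarith)]
      ring
  have h := hA ha hb hx hy hxy
  convert h using 1
  have hy' : (y : ℂ) = 1 - x := by
    rw [← Complex.ofReal_one, ← Complex.ofReal_sub]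
    congr 1
    linarith
  simp only [graphCurve, habs, Complex.real_smul]
  push_cast
  rw [hy']
  ring

/-- All curves begin inside `A` and end inside `B`. Since `A` is met only before the corner and `B`
only after it, convexity shows that each is met in an initial or final interval, so
`exists_connects_subarc` trims the curve without losing anything outside `A ∪ B`. -/
theorem le_conformalModulus_crossingFamily {A B U : Set ℂ} {z₀ e : ℂ} {κ p q c₁ c₂ m : ℝ}
    (he : ‖e‖ = 1) (hp : p < 0) (hq : 0 < q) (hA : IsClosed A) (hB : IsClosed B)
    (hAc : Convex ℝ A) (hBc : Convex ℝ B) (hAB : Disjoint A B)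
    (hpA : ∀ c ∈ Icc c₁ c₂, graphCurve z₀ e κ c p ∈ A)
    (hqB : ∀ c ∈ Icc c₁ c₂, graphCurve z₀ e κ c q ∈ B)
    (hAs : ∀ c ∈ Icc c₁ c₂, ∀ s ∈ Icc p q, graphCurve z₀ e κ c s ∈ A → s ≤ 0)
    (hBs : ∀ c ∈ Icc c₁ c₂, ∀ s ∈ Icc p q, graphCurve z₀ e κ c s ∈ B → 0 ≤ s)
    (hU : ∀ c ∈ Icc c₁ c₂, ∀ s ∈ Icc p q, graphCurve z₀ e κ c s ∈ A ∪ B ∪ U)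
    (hm : m * ((1 + κ ^ 2) * (q - p)) ≤ c₂ - c₁) :
    ENNReal.ofReal m ≤ conformalModulus (crossingFamily A B U
      {S | ∃ c ∈ Icc c₁ c₂, S = graphCurve z₀ e κ c '' Icc p q}) := by
  have hpq : p < q := hp.trans hq
  refine le_conformalModulus_of_graphCurve (z₀ := z₀) he hpq (fun c hc => ?_) hm
  obtain ⟨γ, h1, h2, h3, h4, h5⟩ := exists_connects_subarc (continuous_graphCurve z₀ e κ c) hpq.le
    hA hB hAB (hpA c hc) (hqB c hc) (hU c hc)
    (fun s hs hsA s' hs' => graphCurve_mem_of_convex hAc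
      (mul_nonneg_of_nonpos_of_nonpos hp.le (hAs c hc s hs hsA)) (hpA c hc) hsA hs')
    (fun s hs hsB s' hs' => graphCurve_mem_of_convex hBc
      (mul_nonneg (hBs c hc s hs hsB) hq.le) hsB (hqB c hc) hs')
  exact ⟨γ, ⟨h4, _, ⟨c, hc, rfl⟩, h5⟩, h1, h2, h3⟩

/-! ### Parameters of the construction -/

/-- The inequalities between the lengths of one level. -/
structure Level.Regular (p : Level) : Prop where
  t_pos : 0 < p.t
  t_le : 100 * p.t ≤ p.δ
  δ_le : 1000 * p.δ ≤ p.r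

theorem Level.Regular.halfSide_mul_relWidth {p : Level} (hp : p.Regular) :
    p.halfSide * p.relWidth = p.t := by
  have h : p.halfSide ≠ 0 := by
    unfold Level.halfSide
    linarith [hp.t_pos, hp.t_le, hp.δ_le]
  unfold Level.relWidth
  field_simp

theorem firstLevel_regular : firstLevel.Regular := by
  constructor <;> norm_num [firstLevel, blockHalfLength]

theorem firstLevel_r_le : firstLevel.r ≤ 1 / 4 := by
  norm_num [firstLevel, blockHalfLength]

/-- The relations between the parameters `p` of a level and the parameters `q` of the next one, where
`M` is the number of rectangles on each half of a side. -/
structure IsRefinement (p q : Level) (M : ℤ) : Prop where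
  N_eq : q.N = 2 * M
  le_M : 100 ≤ M
  r_eq : q.r = p.halfSide * q.s
  δ_eq : q.δ = p.halfSide * q.a
  sum_eq : 2 * (M : ℝ) * q.r + ((M : ℝ) - 1) * q.δ = p.r - p.δ / 2
  r_le : 200 * q.r ≤ p.t

theorem nextLevel_regular_and_isRefinement {p : Level} (hp : p.Regular) {m : ℕ} (hm : 1 ≤ m) :
    (nextLevel m p).Regular ∧ IsRefinement p (nextLevel m p) ⌈100 / p.relWidth⌉ := by
  have h0 : 0 < p.halfSide := by
    unfold Level.halfSide
    linarith [hp.t_pos, hp.t_le, hp.δ_le]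
  have hw := hp.halfSide_mul_relWidth
  have hw0 : 0 < p.relWidth := by
    have := hp.t_pos
    unfold Level.relWidth
    positivity
  have hw1 : p.relWidth ≤ 1 := by
    unfold Level.relWidth
    rw [div_le_one h0]
    unfold Level.halfSide
    linarith [hp.t_pos, hp.t_le, hp.δ_le]
  set M : ℤ := ⌈100 / p.relWidth⌉ with hM
  have hMw : 100 / p.relWidth ≤ (M : ℝ) := Int.le_ceil _
  have hMw' : 100 ≤ (M : ℝ) * p.relWidth := by rwa [div_le_iff₀ hw0] at hMw
  have hM1 : (100 : ℝ) ≤ M := by nlinarith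
  have hM2 : (100 : ℤ) ≤ M := by exact_mod_cast hM1
  set x : ℝ := (2 * ((2 * M : ℤ) : ℝ)) ^ (2 * m) with hx
  -- This makes `exp x ≥ 1000`, which gives `1000 δ ≤ r` on the next level.
  have hx1 : 1000 ≤ x := by
    have h1 : (2 : ℝ) ≤ 2 * ((2 * M : ℤ) : ℝ) := by push_cast; linarith
    calc (1000 : ℝ) ≤ (2 * ((2 * M : ℤ) : ℝ)) ^ 2 := by push_cast; nlinarith
      _ ≤ x := pow_le_pow_right₀ (by linarith) (by omega)
  set q : ℝ := 1 / Real.exp x with hq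
  have hq0 : 0 < q := by positivity
  have hq1 : 1000 * q ≤ 1 := by
    rw [hq, mul_one_div, div_le_one (Real.exp_pos _)]
    linarith [Real.add_one_le_exp x]
  set s : ℝ := blockHalfLength M q with hs
  have hD : 0 < 2 * (M : ℝ) + ((M : ℝ) - 1) * q := by nlinarith
  have hs0 : 0 < s := by
    rw [hs]
    unfold blockHalfLength
    positivity
  have hsD : s * (2 * (M : ℝ) + ((M : ℝ) - 1) * q) = 1 := by
    rw [hs]
    unfold blockHalfLength
    field_simp
  have hMs : 2 * (M : ℝ) * s ≤ 1 := by
    have : 0 ≤ s * (((M : ℝ) - 1) * q) := by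
      have : 0 ≤ (M : ℝ) - 1 := by linarith
      positivity
    linarith
  -- From `2 M s ≤ 1` and `100 ≤ M * relWidth`; after scaling by `halfSide` this is `200 r ≤ t`
  -- between consecutive levels.
  have hsw : 200 * s ≤ p.relWidth := by
    have h1 : (M : ℝ) * (200 * s) ≤ M * p.relWidth := by linarith
    exact le_of_mul_le_mul_left h1 (by linarith)
  set ε : ℝ := min (p.relWidth / 100) (q * s / 100) with hε
  have hε0 : 0 < ε := lt_min (by positivity) (by positivity)
  have hε1 : ε ≤ q * s / 100 := min_le_right _ _
  have hlev : nextLevel m p = ⟨2 * M, q * s, s, ε, p.halfSide * ε, p.halfSide * s,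
      p.halfSide * (q * s)⟩ := by
    have h2 : 2 * M / 2 = M := by omega
    unfold nextLevel
    simp only [← hM, h2, ← hx, ← hq, ← hs, ← hε]
  rw [hlev]
  refine ⟨⟨by positivity, ?_, ?_⟩, ⟨rfl, hM2, rfl, rfl, ?_, ?_⟩⟩
  · change 100 * (p.halfSide * ε) ≤ p.halfSide * (q * s)
    nlinarith
  · change 1000 * (p.halfSide * (q * s)) ≤ p.halfSide * s
    nlinarith [mul_pos h0 hs0]
  · change 2 * (M : ℝ) * (p.halfSide * s) + ((M : ℝ) - 1) * (p.halfSide * (q * s)) = p.halfSide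
    linear_combination p.halfSide * hsD
  · change 200 * (p.halfSide * s) ≤ p.t
    rw [← hw]
    nlinarith

theorem level_regular : ∀ k, (level k).Regular
  | 0 => firstLevel_regular
  | 1 => firstLevel_regular
  | k + 2 => (nextLevel_regular_and_isRefinement (level_regular (k + 1)) (by omega)).1

theorem exists_isRefinement {k : ℕ} (hk : 1 ≤ k) :
    ∃ M, IsRefinement (level k) (level (k + 1)) M := by
  obtain ⟨k, rfl⟩ := Nat.exists_eq_add_of_le' hk
  exact ⟨_, (nextLevel_regular_and_isRefinement (level_regular (k + 1)) (by omega)).2⟩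

/-! ### Coordinates of the rectangles -/

/-- The first coordinate as a function of the whole word. -/
noncomputable def xWord : List Side → ℝ
  | [] => 0
  | m :: l => xCoord l m

/-- The second coordinate as a function of the whole word. -/
noncomputable def yWord : List ℤ → ℝ
  | [] => 0
  | n :: l => yCoord l n

theorem Side.sign_eq (e : Side) : e.sign = 1 ∨ e.sign = -1 := by
  cases e <;> simp [Side.sign]

theorem xWord_cons {k : ℕ} (hk : 1 ≤ k) {l : List Side} (hl : l.length = k) (m : Side) :
    xWord (m :: l) = xWord l + m.sign * ((level k).t / 2) := by
  obtain _ | ⟨m', l⟩ := l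
  · simp at hl
    omega
  · have h : l.length + 1 = k := by simpa using hl
    simp only [xWord, xCoord]
    rw [h, ← (level_regular k).halfSide_mul_relWidth]
    ring

theorem length_of_mem_nWords : ∀ {k : ℕ} {l : List ℤ}, l ∈ nWords k → l.length = k
  | 0, l, h => by simpa [nWords] using h
  | k + 1, l, h => by
      obtain ⟨n, l', rfl, h', -⟩ := h
      simp [length_of_mem_nWords h']

theorem yWord_cons_lower {k : ℕ} (hk : 1 ≤ k) {M : ℤ}
    (hM : IsRefinement (level k) (level (k + 1)) M) {l : List ℤ} (hl : l.length = k) {n : ℤ}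
    (hn : n ≤ M) : yWord (n :: l) = yWord l - (level k).r + (level (k + 1)).r +
      ((n : ℝ) - 1) * (2 * (level (k + 1)).r + (level (k + 1)).δ) := by
  obtain _ | ⟨m', l⟩ := l
  · simp at hl
    omega
  · have h : l.length + 1 = k := by simpa using hl
    have h2 : l.length + 2 = k + 1 := by omega
    simp only [yWord, yCoord]
    rw [h, h2, if_pos (by have := hM.N_eq; omega), Level.blockCenter, hM.r_eq, hM.δ_eq]
    ring

theorem yWord_cons_upper {k : ℕ} (hk : 1 ≤ k) {M : ℤ}
    (hM : IsRefinement (level k) (level (k + 1)) M) {l : List ℤ} (hl : l.length = k) {n : ℤ}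
    (hn : M < n) : yWord (n :: l) = yWord l + (level k).δ / 2 + (level (k + 1)).r +
      ((n : ℝ) - M - 1) * (2 * (level (k + 1)).r + (level (k + 1)).δ) := by
  obtain _ | ⟨m', l⟩ := l
  · simp at hl
    omega
  · have h : l.length + 1 = k := by simpa using hl
    have h2 : l.length + 2 = k + 1 := by omega
    have h3 : (level (k + 1)).N / 2 = M := by have := hM.N_eq; omega
    simp only [yWord, yCoord]
    rw [h, h2, if_neg (by omega), h3, Level.blockCenter, hM.r_eq, hM.δ_eq]
    push_cast
    ring

/-- A rectangle lies in the lower or in the upper half of its parent. -/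
theorem yWord_cons_bounds {k : ℕ} (hk : 1 ≤ k) {M : ℤ}
    (hM : IsRefinement (level k) (level (k + 1)) M) {l : List ℤ} (hl : l.length = k) {n : ℤ}
    (h1 : 1 ≤ n) (h2 : n ≤ (level (k + 1)).N) :
    (n ≤ M ∧ yWord l - (level k).r + (level (k + 1)).r ≤ yWord (n :: l) ∧
        yWord (n :: l) ≤ yWord l - (level k).δ / 2 - (level (k + 1)).r) ∨
      (M < n ∧ yWord l + (level k).δ / 2 + (level (k + 1)).r ≤ yWord (n :: l) ∧
        yWord (n :: l) ≤ yWord l + (level k).r - (level (k + 1)).r) := by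
  have hq := level_regular (k + 1)
  have hd : 0 < 2 * (level (k + 1)).r + (level (k + 1)).δ := by
    linarith [hq.t_pos, hq.t_le, hq.δ_le]
  have hsum := hM.sum_eq
  have hN := hM.N_eq
  rcases le_or_gt n M with hn | hn
  · refine Or.inl ⟨hn, ?_⟩
    rw [yWord_cons_lower hk hM hl hn]
    have e1 : (1 : ℝ) ≤ n := by exact_mod_cast h1
    have e2 : (n : ℝ) ≤ M := by exact_mod_cast hn
    constructor <;> nlinarith
  · refine Or.inr ⟨hn, ?_⟩
    rw [yWord_cons_upper hk hM hl hn]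
    have e1 : (M : ℝ) + 1 ≤ n := by exact_mod_cast hn
    have e2 : (n : ℝ) ≤ 2 * M := by
      rw [hN] at h2
      exact_mod_cast h2
    constructor <;> nlinarith

/-- Rectangles in different halves of one parent, or in different parents, are separated by at least
the gap of the parent level, which is far larger than their own size. Otherwise both belong to the
same copy of the building block, where the centers form an arithmetic progression. -/
theorem yWord_cons_gap {k : ℕ} (hk : 1 ≤ k) {M : ℤ}
    (hM : IsRefinement (level k) (level (k + 1)) M)
    {l l' : List ℤ} (hl : l.length = k) (hl' : l'.length = k)
    (hll : l ≠ l' → 2 * (level k).r + (level k).δ ≤ |yWord l - yWord l'|) {n n' : ℤ}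
    (h1 : 1 ≤ n) (h2 : n ≤ (level (k + 1)).N) (h1' : 1 ≤ n') (h2' : n' ≤ (level (k + 1)).N) :
    2 * (level (k + 1)).r + (level k).δ ≤ |yWord (n :: l) - yWord (n' :: l')| ∨
      (l = l' ∧ (n ≤ M ↔ n' ≤ M) ∧ yWord (n :: l) - yWord (n' :: l') =
        ((n : ℝ) - n') * (2 * (level (k + 1)).r + (level (k + 1)).δ)) := by
  have hp := level_regular k
  have hd : 0 < (level k).δ := by linarith [hp.t_pos, hp.t_le]
  have b := yWord_cons_bounds hk hM hl h1 h2
  have b' := yWord_cons_bounds hk hM hl' h1' h2'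
  by_cases h : l = l'
  · subst h
    rcases b with ⟨hn, b1, b2⟩ | ⟨hn, b1, b2⟩ <;> rcases b' with ⟨hn', c1, c2⟩ | ⟨hn', c1, c2⟩
    · refine Or.inr ⟨rfl, by tauto, ?_⟩
      rw [yWord_cons_lower hk hM hl hn, yWord_cons_lower hk hM hl hn']
      ring
    · refine Or.inl ?_
      rw [le_abs]
      right
      linarith
    · refine Or.inl ?_
      rw [le_abs]
      left
      linarith
    · refine Or.inr ⟨rfl, by constructor <;> intro <;> omega, ?_⟩
      rw [yWord_cons_upper hk hM hl hn, yWord_cons_upper hk hM hl hn']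
      ring
  · refine Or.inl ?_
    have c := hll h
    have hδ := hp.δ_le
    rw [le_abs] at c ⊢
    rcases c with c | c
    · left
      rcases b with ⟨-, b1, b2⟩ | ⟨-, b1, b2⟩ <;> rcases b' with ⟨-, c1, c2⟩ | ⟨-, c1, c2⟩ <;>
        linarith
    · right
      rcases b with ⟨-, b1, b2⟩ | ⟨-, b1, b2⟩ <;> rcases b' with ⟨-, c1, c2⟩ | ⟨-, c1, c2⟩ <;>
        linarith

theorem yWord_singleton (n : ℤ) : yWord [n] = (level 1).r +
    ((n : ℝ) - 1) * (2 * (level 1).r + (level 1).δ) := rfl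

theorem le_abs_intCast_sub_mul {n n' : ℤ} (h : n ≠ n') {d : ℝ} (hd : 0 ≤ d) :
    d ≤ |((n : ℝ) - n') * d| := by
  rw [abs_mul, abs_of_nonneg hd]
  have h1 : (1 : ℤ) ≤ |n - n'| := Int.one_le_abs (sub_ne_zero.2 h)
  have h2 : (1 : ℝ) ≤ |(n : ℝ) - n'| := by exact_mod_cast h1
  nlinarith

theorem le_abs_yWord_sub {k : ℕ} (hk : 1 ≤ k) {a b : List ℤ} (ha : a ∈ nWords k)
    (hb : b ∈ nWords k) (hab : a ≠ b) :
    2 * (level k).r + (level k).δ ≤ |yWord a - yWord b| := by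
  induction k, hk using Nat.le_induction generalizing a b with
  | base =>
    obtain ⟨n, l, rfl, hl, -⟩ := ha
    obtain ⟨n', l', rfl, hl', -⟩ := hb
    obtain rfl : l = [] := hl
    obtain rfl : l' = [] := hl'
    have hn : n ≠ n' := fun h => hab (by rw [h])
    have hq := level_regular 1
    have hd : 0 ≤ 2 * (level 1).r + (level 1).δ := by linarith [hq.t_pos, hq.t_le, hq.δ_le]
    rw [yWord_singleton, yWord_singleton]
    convert le_abs_intCast_sub_mul hn hd using 2
    ring
  | succ k hk ih =>
    obtain ⟨n, l, rfl, hl, h1, h2⟩ := ha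
    obtain ⟨n', l', rfl, hl', h1', h2'⟩ := hb
    obtain ⟨M, hM⟩ := exists_isRefinement hk
    have hp := level_regular k
    have hq := level_regular (k + 1)
    rcases yWord_cons_gap hk hM (length_of_mem_nWords hl) (length_of_mem_nWords hl')
      (fun h => ih hl hl' h) h1 h2 h1' h2' with h | ⟨rfl, -, h⟩
    · linarith [hM.r_le, hp.t_le, hq.δ_le, hq.t_le, hq.t_pos, hp.t_pos]
    · rw [h]
      refine le_abs_intCast_sub_mul (fun h => hab (by rw [h])) ?_
      linarith [hq.t_pos, hq.t_le, hq.δ_le]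

/-- Siblings are t_k ≥ 200 r_{k+1} apart, and distinct parents, at distance 10 r_k, come closer by
at most t_k when each child is shifted by t_k / 2. -/
theorem le_abs_xWord_sub {k : ℕ} (hk : 1 ≤ k) {a b : List Side} (ha : a.length = k)
    (hb : b.length = k) (hab : a ≠ b) : 10 * (level k).r ≤ |xWord a - xWord b| := by
  induction k, hk using Nat.le_induction generalizing a b with
  | base =>
    obtain ⟨m, rfl⟩ := List.length_eq_one_iff.1 ha
    obtain ⟨m', rfl⟩ := List.length_eq_one_iff.1 hb
    -- The two columns of level one are at distance 4.
    have h : (level 1).r ≤ 1 / 4 := firstLevel_r_le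
    cases m <;> cases m' <;> simp [xWord, xCoord, Side.sign] at hab ⊢ <;> norm_num <;> linarith
  | succ k hk ih =>
    obtain ⟨m, a, rfl⟩ := List.exists_cons_of_length_eq_add_one ha
    obtain ⟨m', b, rfl⟩ := List.exists_cons_of_length_eq_add_one hb
    have ha : a.length = k := by simpa using ha
    have hb : b.length = k := by simpa using hb
    obtain ⟨M, hM⟩ := exists_isRefinement hk
    have hp := level_regular k
    have hr := hM.r_le
    rw [xWord_cons hk ha, xWord_cons hk hb]
    by_cases h : a = b
    · subst h
      have hm : m ≠ m' := fun h => hab (by rw [h])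
      cases m <;> cases m' <;> simp [Side.sign] at hm ⊢ <;> rw [le_abs]
      · right
        linarith [hp.t_pos]
      · left
        linarith [hp.t_pos]
    · have := ih ha hb h
      have h1 := hp.t_le
      have h2 := hp.δ_le
      have h3 := hp.t_pos
      rw [le_abs] at this ⊢
      rcases this with c | c
      · left
        rcases m.sign_eq with e | e <;> rcases m'.sign_eq with e' | e' <;> rw [e, e'] <;> linarith
      · right
        rcases m.sign_eq with e | e <;> rcases m'.sign_eq with e' | e' <;> rw [e, e'] <;> linarith

/-! ### Disks and their distance from deeper columns -/

theorem mem_disk_iff {k : ℕ} {w : Word} {e : Side} {p : ℂ} :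
    p ∈ disk k w e ↔ (p.re - (w.x + e.sign * (2 * (level k).t + (level k).r))) ^ 2 +
      (p.im - w.y) ^ 2 ≤ (level k).r ^ 2 := by
  have hp := level_regular k
  have hr : 0 ≤ (level k).r := by linarith [hp.t_pos, hp.t_le, hp.δ_le]
  rw [disk, Metric.mem_closedBall, Complex.dist_eq_re_im, Real.sqrt_le_left hr]

theorem bounds_of_mem_disk {k : ℕ} {w : Word} {e : Side} {p : ℂ} (h : p ∈ disk k w e) :
    |p.re - (w.x + e.sign * (2 * (level k).t + (level k).r))| ≤ (level k).r ∧
      |p.im - w.y| ≤ (level k).r := by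
  have hp := level_regular k
  have hr : 0 ≤ (level k).r := by linarith [hp.t_pos, hp.t_le, hp.δ_le]
  have h' := mem_disk_iff.1 h
  exact ⟨abs_le_of_sq_le_sq ((le_add_of_nonneg_right (sq_nonneg _)).trans h') hr,
    abs_le_of_sq_le_sq ((le_add_of_nonneg_left (sq_nonneg _)).trans h') hr⟩

/-- The disks of the lower levels keep away from the vertical line through the center of a rectangle
of level `k`. -/
theorem le_abs_re_sub_xWord_of_mem_disk {k : ℕ} {a : List Side} (ha : a.length = k) {j : ℕ}
    (hj : 1 ≤ j) (hjk : j < k) {v : Word} (hv : v ∈ wordsOfLength j) {e : Side} {p : ℂ}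
    (hp : p ∈ disk j v e) : 4 * (level k).r ≤ |p.re - xWord a| := by
  induction k generalizing a with
  | zero => omega
  | succ k ih =>
    obtain ⟨m, a, rfl⟩ := List.exists_cons_of_length_eq_add_one ha
    have ha : a.length = k := by simpa using ha
    have hk : 1 ≤ k := by omega
    obtain ⟨M, hM⟩ := exists_isRefinement hk
    have hr := hM.r_le
    obtain ⟨h3, h1, h2⟩ := level_regular k
    -- Every disk of level at most `k` stays `2t` away from the parent's axis: the parent's own
    -- disks begin there, and those of other columns and lower levels are farther. The child's axis
    -- is only `t / 2` off, which leaves `3t / 2`, more than four radii of the next level.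
    have key : 2 * (level k).t ≤ |p.re - xWord a| := by
      rcases Nat.lt_succ_iff_lt_or_eq.1 hjk with h | rfl
      · linarith [ih ha h]
      · have hb := (bounds_of_mem_disk hp).1
        have hx : v.x = xWord (v.m :: v.mInit) := rfl
        rw [hx] at hb
        by_cases hc : a = v.m :: v.mInit
        · rw [← hc, abs_le] at hb
          rw [le_abs]
          rcases e.sign_eq with he | he <;> rw [he] at hb
          · left
            linarith
          · right
            linarith
        · have hs := le_abs_xWord_sub hk ha hv.1 hc
          rw [abs_le] at hb
          rw [le_abs] at hs ⊢
          rcases hs with hs | hs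
          · right
            rcases e.sign_eq with he | he <;> rw [he] at hb <;> linarith
          · left
            rcases e.sign_eq with he | he <;> rw [he] at hb <;> linarith
    rw [xWord_cons hk ha]
    rw [le_abs] at key ⊢
    rcases key with c | c
    · left
      rcases m.sign_eq with e | e <;> rw [e] <;> linarith
    · right
      rcases m.sign_eq with e | e <;> rw [e] <;> linarith

/-! ### Location of the disks and of the Cantor set relative to one level -/

/-- The rectangle `R^w` without its middle gap. -/
def halfRects (k : ℕ) (w : Word) : Set ℂ :=
  {p | |p.re - w.x| ≤ (level k).t ∧ (level k).δ / 2 ≤ |p.im - w.y| ∧ |p.im - w.y| ≤ (level k).r}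

theorem exists_parent {k : ℕ} {w : Word} (hk : 1 ≤ k) (hw : w ∈ wordsOfLength (k + 1)) :
    ∃ u ∈ wordsOfLength k, w.mInit = u.m :: u.mInit ∧ w.nInit = u.n :: u.nInit ∧ 1 ≤ w.n ∧
      w.n ≤ (level (k + 1)).N := by
  obtain ⟨h1, n, l, h2, hl, hn⟩ := hw
  obtain ⟨mI, m, nI, n'⟩ := w
  simp only [List.cons.injEq] at h2
  obtain ⟨rfl, rfl⟩ := h2
  have h3 : mI.length = k := by simpa using h1
  have h4 := length_of_mem_nWords hl
  obtain ⟨k, rfl⟩ := Nat.exists_eq_add_of_le' hk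
  obtain ⟨m', mI, rfl⟩ := List.exists_cons_of_length_eq_add_one h3
  obtain ⟨n', nI, rfl⟩ := List.exists_cons_of_length_eq_add_one h4
  exact ⟨⟨mI, m', nI, n'⟩, ⟨h3, hl⟩, rfl, rfl, hn⟩

/-- The smallest box which contains a rectangle and its two disks. -/
def outerBox (k : ℕ) (w : Word) : Set ℂ :=
  {p | |p.re - w.x| ≤ 2 * (level k).t + 2 * (level k).r ∧ |p.im - w.y| ≤ (level k).r}

theorem disk_subset_outerBox (k : ℕ) (w : Word) (e : Side) : disk k w e ⊆ outerBox k w := by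
  intro p hp
  obtain ⟨h1, h2⟩ := bounds_of_mem_disk hp
  obtain ⟨r1, r2, r3⟩ := level_regular k
  refine ⟨?_, h2⟩
  rw [abs_le] at h1 ⊢
  rcases e.sign_eq with he | he <;> rw [he] at h1 <;> constructor <;> linarith

theorem rect_subset_outerBox (k : ℕ) (w : Word) : rect k w ⊆ outerBox k w := by
  rintro p ⟨h1, h2⟩
  obtain ⟨r1, r2, r3⟩ := level_regular k
  have h1 : p.re ∈ Icc _ _ := h1
  have h2 : p.im ∈ Icc _ _ := h2
  exact ⟨abs_le.2 ⟨by linarith [h1.1], by linarith [h1.2]⟩,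
    abs_le.2 ⟨by linarith [h2.1], by linarith [h2.2]⟩⟩

theorem halfRects_subset_outerBox (k : ℕ) (w : Word) : halfRects k w ⊆ outerBox k w := by
  rintro p ⟨h1, -, h2⟩
  obtain ⟨r1, r2, r3⟩ := level_regular k
  exact ⟨by linarith, h2⟩

/-- Horizontally, the shift t_k / 2 and the half-width 2 t_{k+1} + 2 r_{k+1} of the box together
stay below t_k. Vertically, the children were placed over the two segments left by the middle gap.
-/
theorem exists_outerBox_subset_halfRects_pred {k : ℕ} (hk : 1 ≤ k) {w : Word}
    (hw : w ∈ wordsOfLength (k + 1)) :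
    ∃ u ∈ wordsOfLength k, outerBox (k + 1) w ⊆ halfRects k u := by
  obtain ⟨u, hu, hm, hn, h1, h2⟩ := exists_parent hk hw
  refine ⟨u, hu, fun p ⟨hp1, hp2⟩ => ?_⟩
  obtain ⟨M, hM⟩ := exists_isRefinement hk
  have hr := hM.r_le
  obtain ⟨r1, r2, r3⟩ := level_regular k
  obtain ⟨q1, q2, q3⟩ := level_regular (k + 1)
  have hx : w.x = u.x + w.m.sign * ((level k).t / 2) := by
    have := xWord_cons hk hu.1 w.m
    rwa [← hm, show xWord w.mInit = u.x by rw [hm]; rfl] at this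
  have hy := yWord_cons_bounds hk hM (length_of_mem_nWords hu.2) h1 h2
  rw [← hn] at hy
  have e1 : yWord (w.n :: w.nInit) = w.y := rfl
  have e2 : yWord w.nInit = u.y := by rw [hn]; rfl
  rw [e1, e2] at hy
  rw [hx] at hp1
  rw [abs_le] at hp1 hp2
  refine ⟨?_, ?_, ?_⟩
  · rw [abs_le]
    rcases w.m.sign_eq with he | he <;> rw [he] at hp1 <;> constructor <;> linarith
  · rw [le_abs]
    rcases hy with ⟨-, h3, h4⟩ | ⟨-, h3, h4⟩
    · right
      linarith
    · left
      linarith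
  · rw [abs_le]
    rcases hy with ⟨-, h3, h4⟩ | ⟨-, h3, h4⟩ <;> constructor <;> linarith

theorem exists_outerBox_subset_halfRects {k j : ℕ} (hk : 1 ≤ k) (hkj : k < j) {w : Word}
    (hw : w ∈ wordsOfLength j) : ∃ u ∈ wordsOfLength k, outerBox j w ⊆ halfRects k u := by
  induction j, hkj using Nat.le_induction generalizing w with
  | base => exact exists_outerBox_subset_halfRects_pred hk hw
  | succ j hj ih =>
    obtain ⟨u, hu, hsub⟩ := exists_outerBox_subset_halfRects_pred (hk.trans (by omega)) hw
    obtain ⟨u', hu', hsub'⟩ := ih hu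
    exact ⟨u', hu', hsub.trans ((halfRects_subset_outerBox j u).trans hsub')⟩

theorem exists_mem_halfRects_of_mem_cantorProduct {k : ℕ} (hk : 1 ≤ k) {p : ℂ}
    (hp : p ∈ cantorProduct) : ∃ v ∈ wordsOfLength k, p ∈ halfRects k v := by
  -- Level `k` alone does not exclude the middle gap; the rectangles of level `k + 1` avoid it.
  have h := mem_iInter₂.1 hp (k + 1) (by simp)
  obtain ⟨w, hw, hpw⟩ := mem_iUnion₂.1 h
  obtain ⟨u, hu, hsub⟩ := exists_outerBox_subset_halfRects_pred hk hw
  exact ⟨u, hu, hsub (rect_subset_outerBox _ _ hpw)⟩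

/-- Near a column of level `k`, the complement of `Ω` consists of parts of the disks and of the
rectangles of that column. -/
theorem exists_of_mem_obstacle {k : ℕ} (hk : 1 ≤ k) {w : Word} (hw : w ∈ wordsOfLength k) {p : ℂ}
    (hpx : |p.re - w.x| ≤ 3 * (level k).r) (hp : p ∉ OmegaFinite) :
    ∃ v ∈ wordsOfLength k, v.m = w.m ∧ v.mInit = w.mInit ∧
      ((∃ e, p ∈ disk k v e) ∨ p ∈ halfRects k v) := by
  have hp' : p ∈ allDisks ∪ cantorProduct := by
    have h1 : (p : OnePoint ℂ) ∉ Omega := hp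
    rw [Omega, notMem_compl_iff] at h1
    obtain ⟨q, hq, hqp⟩ := h1
    rwa [OnePoint.coe_injective hqp] at hq
  obtain ⟨r1, r2, r3⟩ := level_regular k
  have key : ∃ v ∈ wordsOfLength k, (∃ e, p ∈ disk k v e) ∨ p ∈ halfRects k v := by
    rcases hp' with h | h
    · obtain ⟨j, hj, h⟩ := mem_iUnion₂.1 h
      obtain ⟨v, hv, h⟩ := mem_iUnion₂.1 h
      obtain ⟨e, he⟩ : ∃ e, p ∈ disk j v e := by
        rcases h with h | h
        exacts [⟨_, h⟩, ⟨_, h⟩]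
      rcases lt_trichotomy j k with hjk | rfl | hjk
      · have := le_abs_re_sub_xWord_of_mem_disk hw.1 hj hjk hv he
        have e1 : xWord (w.m :: w.mInit) = w.x := rfl
        rw [e1] at this
        linarith
      · exact ⟨v, hv, Or.inl ⟨e, he⟩⟩
      · obtain ⟨u, hu, hsub⟩ := exists_outerBox_subset_halfRects hk hjk hv
        exact ⟨u, hu, Or.inr (hsub (disk_subset_outerBox _ _ _ he))⟩
    · obtain ⟨v, hv, h⟩ := exists_mem_halfRects_of_mem_cantorProduct hk h
      exact ⟨v, hv, Or.inr h⟩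
  obtain ⟨v, hv, h⟩ := key
  have hbox : p ∈ outerBox k v := by
    rcases h with ⟨e, he⟩ | h
    exacts [disk_subset_outerBox _ _ _ he, halfRects_subset_outerBox _ _ h]
  -- Another column is at distance `10r`, while the box of `v` reaches only `2t + 2r` and the point
  -- is within `3r` of the axis of `w`.
  have hcol : v.m :: v.mInit = w.m :: w.mInit := by
    by_contra hne
    have h1 : 10 * (level k).r ≤ |v.x - w.x| := le_abs_xWord_sub hk hv.1 hw.1 hne
    have h2 := hbox.1
    have h3 := abs_sub_le v.x p.re w.x
    rw [abs_sub_comm v.x p.re] at h3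
    linarith
  simp only [List.cons.injEq] at hcol
  exact ⟨v, hv, hcol.1, hcol.2, h⟩

/-! ### The crossing families -/

/-- The other side. -/
def Side.opp : Side → Side
  | Side.Le => Side.Ri
  | Side.Ri => Side.Le

theorem Side.sign_opp (b : Side) : b.opp.sign = -b.sign := by
  cases b <;> simp [Side.opp, Side.sign]

theorem Side.eq_or_eq_opp (b e : Side) : e = b ∨ e = b.opp := by
  cases b <;> cases e <;> simp [Side.opp]

theorem mem_disk_iff_sign_mul {k : ℕ} {w : Word} {e : Side} {p : ℂ} :
    p ∈ disk k w e ↔ (e.sign * (p.re - w.x) - (2 * (level k).t + (level k).r)) ^ 2 +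
      (p.im - w.y) ^ 2 ≤ (level k).r ^ 2 := by
  rw [mem_disk_iff]
  have h : (p.re - (w.x + e.sign * (2 * (level k).t + (level k).r))) ^ 2 =
      (e.sign * (p.re - w.x) - (2 * (level k).t + (level k).r)) ^ 2 := by
    rcases e.sign_eq with h | h <;> rw [h] <;> ring
  rw [h]

theorem sign_mul_re_sub_of_mem_disk {k : ℕ} {w : Word} {e : Side} {p : ℂ} (h : p ∈ disk k w e) :
    2 * (level k).t ≤ e.sign * (p.re - w.x) ∧
      e.sign * (p.re - w.x) ≤ 2 * (level k).t + 2 * (level k).r := by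
  have h1 := abs_le.1 (bounds_of_mem_disk h).1
  rcases e.sign_eq with he | he <;> rw [he] at h1 ⊢ <;> constructor <;> linarith [h1.1, h1.2]

theorem isClosed_disk (k : ℕ) (w : Word) (e : Side) : IsClosed (disk k w e) :=
  Metric.isClosed_closedBall

theorem convex_disk (k : ℕ) (w : Word) (e : Side) : Convex ℝ (disk k w e) :=
  convex_closedBall _ _

theorem disjoint_disk_opp (k : ℕ) (w : Word) (b : Side) :
    Disjoint (disk k w b.opp) (disk k w b) := by
  refine disjoint_left.2 fun p h1 h2 => ?_
  have h1 := (sign_mul_re_sub_of_mem_disk h1).1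
  have h2 := (sign_mul_re_sub_of_mem_disk h2).1
  rw [b.sign_opp] at h1
  linarith [(level_regular k).t_pos]

/-- In a fixed column the height alone determines the word; this identifies the obstacle that a
curve hits. -/
theorem Word.eq_of_abs_y_sub_lt {k : ℕ} (hk : 1 ≤ k) {v w : Word} (hv : v ∈ wordsOfLength k)
    (hw : w ∈ wordsOfLength k) (hm : v.m = w.m) (hmI : v.mInit = w.mInit)
    (h : |v.y - w.y| < 2 * (level k).r + (level k).δ) : v = w := by
  have h1 : v.n :: v.nInit = w.n :: w.nInit := by
    by_contra hne
    exact absurd (le_abs_yWord_sub hk hv.2 hw.2 hne) (not_le.2 h)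
  obtain ⟨a, b, c, d⟩ := v
  simp only [List.cons.injEq] at h1
  simp only at hm hmI
  rw [hm, hmI, h1.1, h1.2]

/-- There is a family of paths that connect `A` and `B` in `Ω`, of modulus at least `1 / 10`, such
that the union of `A`, `B` and a path of the family always has the property `P`. -/
def HasCrossing (A B : Set ℂ) (P : Set ℂ → Prop) : Prop :=
  ∃ Γ : Set PlanePath, (∀ γ ∈ Γ, γ.Connects A B OmegaFinite) ∧ 1 / 10 ≤ conformalModulus Γ ∧
    ∀ γ ∈ Γ, P (γ.trace ∪ A ∪ B)

/-- The property `P` needs to be checked only for sets containing a whole uncut curve, because the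
pieces that were cut off lie in `A` and `B`. -/
theorem hasCrossing_of_graphCurve {A B : Set ℂ} {P : Set ℂ → Prop} {z₀ e : ℂ}
    {κ p q c₁ c₂ : ℝ} (he : ‖e‖ = 1) (hp : p < 0) (hq : 0 < q) (hA : IsClosed A)
    (hB : IsClosed B) (hAc : Convex ℝ A) (hBc : Convex ℝ B) (hAB : Disjoint A B)
    (hpA : ∀ c ∈ Icc c₁ c₂, graphCurve z₀ e κ c p ∈ A)
    (hqB : ∀ c ∈ Icc c₁ c₂, graphCurve z₀ e κ c q ∈ B)
    (hAs : ∀ c ∈ Icc c₁ c₂, ∀ s ∈ Icc p q, graphCurve z₀ e κ c s ∈ A → s ≤ 0)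
    (hBs : ∀ c ∈ Icc c₁ c₂, ∀ s ∈ Icc p q, graphCurve z₀ e κ c s ∈ B → 0 ≤ s)
    (hU : ∀ c ∈ Icc c₁ c₂, ∀ s ∈ Icc p q, graphCurve z₀ e κ c s ∉ OmegaFinite →
      graphCurve z₀ e κ c s ∈ A ∪ B)
    (hm : (1 + κ ^ 2) * (q - p) ≤ 10 * (c₂ - c₁))
    (hP : ∀ c ∈ Icc c₁ c₂, ∀ T, (∀ s ∈ Icc p q, graphCurve z₀ e κ c s ∈ T) → P T) :
    HasCrossing A B P := by
  refine ⟨crossingFamily A B OmegaFinite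
      {S | ∃ c ∈ Icc c₁ c₂, S = graphCurve z₀ e κ c '' Icc p q}, fun γ h => h.1, ?_, ?_⟩
  · have h := le_conformalModulus_crossingFamily (U := OmegaFinite) (m := 1 / 10) he hp hq hA hB
      hAc hBc hAB hpA hqB hAs hBs (fun c hc s hs => ?_) (by linarith)
    · refine le_trans (le_of_eq ?_) h
      rw [ENNReal.ofReal_div_of_pos (by norm_num), ENNReal.ofReal_one, ENNReal.ofReal_ofNat]
    · by_cases hO : graphCurve z₀ e κ c s ∈ OmegaFinite
      exacts [Or.inr hO, Or.inl (hU c hc s hs hO)]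
  · rintro γ ⟨-, _, ⟨c, hc, rfl⟩, hsub⟩
    exact hP c hc _ fun s hs => hsub ⟨s, hs, rfl⟩

theorem graphCurve_sign (x y : ℝ) (b κ c s : ℝ) :
    (graphCurve ⟨x, y⟩ b κ c s).re = x + b * s ∧
      (graphCurve ⟨x, y⟩ b κ c s).im = y + b * (κ * |s| + c) := by
  rw [graphCurve_eq_mk]
  simp

theorem graphCurve_sign_mul_I (x y : ℝ) (τ c s : ℝ) :
    (graphCurve ⟨x, y⟩ (τ * Complex.I) 0 c s).re = x - τ * c ∧
      (graphCurve ⟨x, y⟩ (τ * Complex.I) 0 c s).im = y + τ * s := by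
  rw [graphCurve_eq_mk]
  constructor
  · simp
    ring
  · simp

theorem Side.norm_sign (b : Side) : ‖(b.sign : ℂ)‖ = 1 := by
  rcases b.sign_eq with h | h <;> simp [h]

/-- `T` contains a horizontal segment through the middle gap of `R^v`, up to the disks. -/
def GapBarrier (k : ℕ) (v : Word) (T : Set ℂ) : Prop :=
  ∃ c, |c| ≤ (level k).δ / 4 ∧ ∀ p : ℂ, |p.re - v.x| ≤ 2 * (level k).t + (level k).δ →
    p.im = v.y + c → p ∈ T

/-- The segments enter each disk to depth `δ`. Their heights vary in an interval of length `δ / 2`,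
inside the middle gap, and their length `2(2t + δ)` is at most `2.04 δ`. -/
theorem hasCrossing_gap {k : ℕ} (hk : 1 ≤ k) {v : Word} (hv : v ∈ wordsOfLength k) (b : Side) :
    HasCrossing (disk k v b.opp) (disk k v b) (GapBarrier k v) := by
  obtain ⟨r1, r2, r3⟩ := level_regular k
  set K := level k with hK
  have hbb : b.sign * b.sign = 1 := by rcases b.sign_eq with h | h <;> rw [h] <;> norm_num
  have hquad : ∀ c ∈ Icc (-(K.δ / 4)) (K.δ / 4), (K.r - K.δ) ^ 2 + c ^ 2 ≤ K.r ^ 2 := by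
    intro c hc
    have : c ^ 2 ≤ (K.δ / 4) ^ 2 := sq_le_sq' hc.1 hc.2
    nlinarith
  have hre : ∀ (e : Side) (c s : ℝ), e.sign * ((graphCurve ⟨v.x, v.y⟩ b.sign 0 c s).re - v.x) =
      e.sign * b.sign * s := fun e c s => by
    rw [(graphCurve_sign v.x v.y b.sign 0 c s).1]
    ring
  have him : ∀ c s : ℝ, (graphCurve ⟨v.x, v.y⟩ b.sign 0 c s).im - v.y = b.sign * c :=
    fun c s => by
    rw [(graphCurve_sign v.x v.y b.sign 0 c s).2]
    ring
  have hsq : ∀ c : ℝ, (b.sign * c) ^ 2 = c ^ 2 := fun c => by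
    rw [mul_pow, pow_two b.sign, hbb, one_mul]
  have habs : ∀ c ∈ Icc (-(K.δ / 4)) (K.δ / 4), |b.sign * c| ≤ K.δ / 4 := fun c hc => by
    rw [abs_le]
    rcases b.sign_eq with h | h <;> rw [h] <;> constructor <;> linarith [hc.1, hc.2]
  refine hasCrossing_of_graphCurve (z₀ := ⟨v.x, v.y⟩) (e := b.sign) (κ := 0)
    (p := -(2 * K.t + K.δ)) (q := 2 * K.t + K.δ) (c₁ := -(K.δ / 4)) (c₂ := K.δ / 4)
    b.norm_sign (by linarith) (by linarith) (isClosed_disk _ _ _) (isClosed_disk _ _ _)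
    (convex_disk _ _ _) (convex_disk _ _ _) (disjoint_disk_opp _ _ _) ?_ ?_ ?_ ?_ ?_ ?_ ?_
  · intro c hc
    rw [mem_disk_iff_sign_mul, hre, him, b.sign_opp, hsq, neg_mul, hbb, ← hK]
    linarith [hquad c hc]
  · intro c hc
    rw [mem_disk_iff_sign_mul, hre, him, hsq, hbb, ← hK]
    linarith [hquad c hc]
  · intro c _ s _ h
    have h := (sign_mul_re_sub_of_mem_disk h).1
    rw [hre, b.sign_opp, neg_mul, hbb] at h
    linarith
  · intro c _ s _ h
    have h := (sign_mul_re_sub_of_mem_disk h).1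
    rw [hre, hbb] at h
    linarith
  · intro c hc s hs hO
    have hx : |(graphCurve ⟨v.x, v.y⟩ b.sign 0 c s).re - v.x| ≤ 3 * K.r := by
      rw [(graphCurve_sign v.x v.y b.sign 0 c s).1, abs_le]
      rcases b.sign_eq with h | h <;> rw [h] <;> constructor <;> linarith [hs.1, hs.2]
    have hy : |(graphCurve ⟨v.x, v.y⟩ b.sign 0 c s).im - v.y| ≤ K.δ / 4 := by
      rw [him]
      exact habs c hc
    obtain ⟨v', hv', hm, hmI, h⟩ := exists_of_mem_obstacle hk hv hx hO
    have hy' : |(graphCurve ⟨v.x, v.y⟩ b.sign 0 c s).im - v'.y| ≤ K.r := by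
      rcases h with ⟨e, he⟩ | h
      exacts [(bounds_of_mem_disk he).2, h.2.2]
    obtain rfl : v' = v := by
      refine Word.eq_of_abs_y_sub_lt hk hv' hv hm hmI ?_
      rw [← hK]
      rw [abs_le] at hy hy'
      rw [abs_lt]
      constructor <;> linarith [hy.1, hy.2, hy'.1, hy'.2]
    rcases h with ⟨e, he⟩ | h
    · rcases b.eq_or_eq_opp e with rfl | rfl
      exacts [Or.inr he, Or.inl he]
    · have := h.2.1
      rw [← hK] at this
      linarith
  · linarith
  · intro c hc T hT
    refine ⟨b.sign * c, habs c hc, fun p hp1 hp2 => ?_⟩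
    have h := hT (b.sign * (p.re - v.x)) ?_
    · convert h using 1
      apply Complex.ext
      · rw [(graphCurve_sign v.x v.y b.sign 0 c _).1, ← mul_assoc, hbb]
        ring
      · rw [(graphCurve_sign v.x v.y b.sign 0 c _).2, hp2]
        ring
    · rw [abs_le] at hp1
      rcases b.sign_eq with h | h <;> rw [h] <;> constructor <;> linarith [hp1.1, hp1.2]

/-- `T` contains a vertical segment between two consecutive disks of a column, up to the disks;
`y` is the height of the middle of the gap between them. -/
def SideBarrier (k : ℕ) (b : Side) (x y : ℝ) (T : Set ℂ) : Prop :=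
  ∃ u, |u - (2 * (level k).t + (level k).r)| ≤ (level k).δ / 2 ∧
    ∀ p : ℂ, b.sign * (p.re - x) = u → |p.im - y| ≤ 3 / 2 * (level k).δ → p ∈ T

/-- A strip of width `δ` and length `3δ` around the line joining the centers, which enters each disk
to depth about `δ`. The sign `τ` is the direction of travel, up for 1 and down for -1. -/
theorem hasCrossing_side {k : ℕ} (hk : 1 ≤ k) {v v' : Word} (hv : v ∈ wordsOfLength k)
    (hv' : v' ∈ wordsOfLength k) (hm : v'.m = v.m) (hmI : v'.mInit = v.mInit) (b : Side)
    {τ y : ℝ} (hτ : τ = 1 ∨ τ = -1) (hy : v.y = y - τ * ((level k).r + (level k).δ / 2))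
    (hy' : v'.y = y + τ * ((level k).r + (level k).δ / 2)) :
    HasCrossing (disk k v b) (disk k v' b) (SideBarrier k b v.x y) := by
  obtain ⟨r1, r2, r3⟩ := level_regular k
  set K := level k with hK
  have hxx : v'.x = v.x := by unfold Word.x; rw [hm, hmI]
  have hττ : τ * τ = 1 := by rcases hτ with h | h <;> rw [h] <;> norm_num
  set X := v.x + b.sign * (2 * K.t + K.r) with hX
  have hre : ∀ c s : ℝ, (graphCurve ⟨X, y⟩ (τ * Complex.I) 0 c s).re - X = -(τ * c) :=
    fun c s => by
    rw [(graphCurve_sign_mul_I X y τ c s).1]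
    ring
  have him : ∀ c s : ℝ, (graphCurve ⟨X, y⟩ (τ * Complex.I) 0 c s).im = y + τ * s :=
    fun c s => (graphCurve_sign_mul_I X y τ c s).2
  have habs : ∀ c ∈ Icc (-(K.δ / 2)) (K.δ / 2), |τ * c| ≤ K.δ / 2 := fun c hc => by
    rw [abs_le]
    rcases hτ with h | h <;> rw [h] <;> constructor <;> linarith [hc.1, hc.2]
  have hsq : ∀ c : ℝ, (τ * c) ^ 2 = c ^ 2 := fun c => by
    rw [mul_pow, pow_two τ, hττ, one_mul]
  have hquad : ∀ c ∈ Icc (-(K.δ / 2)) (K.δ / 2), c ^ 2 + (K.r - K.δ) ^ 2 ≤ K.r ^ 2 := by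
    intro c hc
    have : c ^ 2 ≤ (K.δ / 2) ^ 2 := sq_le_sq' hc.1 hc.2
    nlinarith
  have hA : ∀ c s, graphCurve ⟨X, y⟩ (τ * Complex.I) 0 c s ∈ disk k v b → s ≤ -(K.δ / 2) := by
    intro c s h
    have h := abs_le.1 (bounds_of_mem_disk h).2
    rw [him, hy, ← hK] at h
    rcases hτ with h' | h' <;> rw [h'] at h <;> linarith [h.1, h.2]
  have hB : ∀ c s, graphCurve ⟨X, y⟩ (τ * Complex.I) 0 c s ∈ disk k v' b → K.δ / 2 ≤ s := by
    intro c s h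
    have h := abs_le.1 (bounds_of_mem_disk h).2
    rw [him, hy', ← hK] at h
    rcases hτ with h' | h' <;> rw [h'] at h <;> linarith [h.1, h.2]
  refine hasCrossing_of_graphCurve (z₀ := ⟨X, y⟩) (e := τ * Complex.I) (κ := 0)
    (p := -(3 / 2 * K.δ)) (q := 3 / 2 * K.δ) (c₁ := -(K.δ / 2)) (c₂ := K.δ / 2)
    ?_ (by linarith) (by linarith) (isClosed_disk _ _ _) (isClosed_disk _ _ _)
    (convex_disk _ _ _) (convex_disk _ _ _) ?_ ?_ ?_ ?_ ?_ ?_ ?_ ?_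
  · rcases hτ with h | h <;> simp [h]
  · refine disjoint_left.2 fun p h1 h2 => ?_
    have h1 := abs_le.1 (bounds_of_mem_disk h1).2
    have h2 := abs_le.1 (bounds_of_mem_disk h2).2
    rw [hy, ← hK] at h1
    rw [hy', ← hK] at h2
    rcases hτ with h' | h' <;> rw [h'] at h1 h2 <;> linarith [h1.1, h1.2, h2.1, h2.2]
  · intro c hc
    rw [mem_disk_iff, him, hy, ← hK, ← hX, hre, neg_sq, hsq]
    have : (y + τ * -(3 / 2 * K.δ) - (y - τ * (K.r + K.δ / 2))) ^ 2 = (K.r - K.δ) ^ 2 := by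
      rw [← hsq (K.r - K.δ)]
      ring
    rw [this]
    exact hquad c hc
  · intro c hc
    rw [mem_disk_iff, hxx, him, hy', ← hK, ← hX, hre, neg_sq, hsq]
    have : (y + τ * (3 / 2 * K.δ) - (y + τ * (K.r + K.δ / 2))) ^ 2 = (K.r - K.δ) ^ 2 := by
      rw [← hsq (K.r - K.δ)]
      ring
    rw [this]
    exact hquad c hc
  · exact fun c _ s _ h => by linarith [hA c s h]
  · exact fun c _ s _ h => by linarith [hB c s h]
  · intro c hc s hs hO
    have hx0 := abs_le.1 (habs c hc)
    have hx1 := hre c s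
    have hy1 := him c s
    set P := graphCurve ⟨X, y⟩ (τ * Complex.I) 0 c s
    have hx : |P.re - v.x| ≤ 3 * K.r := by
      rw [abs_le]
      rcases b.sign_eq with h | h <;> rw [h] at hX <;> constructor <;> linarith [hx0.1, hx0.2]
    obtain ⟨u, hu, hum, humI, h⟩ := exists_of_mem_obstacle hk hv hx hO
    have hux : u.x = v.x := by unfold Word.x; rw [hum, humI]
    rcases h with ⟨e, he⟩ | h
    · obtain rfl : e = b := by
        rcases b.eq_or_eq_opp e with rfl | rfl
        · rfl
        · exfalso
          have := (sign_mul_re_sub_of_mem_disk he).1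
          rw [b.sign_opp, hux] at this
          rcases b.sign_eq with h | h <;> rw [h] at hX this <;> linarith [hx0.1, hx0.2]
      have h2 := (bounds_of_mem_disk he).2
      rw [hy1, ← hK] at h2
      -- Any third disk of the column has its center at distance at least `3r + 3δ/2` from `y`, out
      -- of reach of a curve that stays within `3δ/2` of `y`.
      have hgap : u = v ∨ u = v' := by
        by_contra! hne
        have g1 : 2 * K.r + K.δ ≤ |u.y - v.y| := not_lt.1 fun hlt =>
          hne.1 (Word.eq_of_abs_y_sub_lt hk hu hv hum humI hlt)
        have g2 : 2 * K.r + K.δ ≤ |u.y - v'.y| := not_lt.1 fun hlt =>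
          hne.2 (Word.eq_of_abs_y_sub_lt hk hu hv' (hum.trans hm.symm) (humI.trans hmI.symm) hlt)
        rw [abs_le] at h2
        rw [hy, le_abs] at g1
        rw [hy', le_abs] at g2
        rcases hτ with h | h <;> rw [h] at g1 g2 h2 <;> rcases g1 with g1 | g1 <;>
          rcases g2 with g2 | g2 <;> linarith [hs.1, hs.2, h2.1, h2.2]
      rcases hgap with rfl | rfl
      exacts [Or.inl he, Or.inr he]
    · exfalso
      have h1 := abs_le.1 h.1
      rw [hux, ← hK] at h1
      rcases b.sign_eq with h | h <;> rw [h] at hX <;> linarith [hx0.1, hx0.2, h1.1, h1.2]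
  · linarith
  · intro c hc T hT
    have hx0 := abs_le.1 (habs c hc)
    refine ⟨2 * K.t + K.r - b.sign * (τ * c), ?_, fun p hp1 hp2 => ?_⟩
    · rw [abs_le, ← hK]
      rcases b.sign_eq with h | h <;> rw [h] <;> constructor <;> linarith [hx0.1, hx0.2]
    have h := hT (τ * (p.im - y)) ?_
    · convert h using 1
      apply Complex.ext
      · have := hre c (τ * (p.im - y))
        rcases b.sign_eq with h | h <;> rw [h] at hX hp1 <;> linarith
      · rw [him, ← mul_assoc, hττ]
        ring
    · rw [abs_le] at hp2
      rcases hτ with h | h <;> rw [h] <;> constructor <;> linarith [hp2.1, hp2.2]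

/-- `T` contains, up to the disks, a path which goes from one disk to the other and passes below
(`b = Ri`) or above (`b = Le`) the rectangle `R^w`. -/
def WedgeBarrier (k : ℕ) (b : Side) (w : Word) (T : Set ℂ) : Prop :=
  ∃ c, 2 * (level k).t + (level k).r ≤ c ∧
    c ≤ 2 * (level k).t + (level k).r + 9 / 10 * (level k).r ∧
    ∀ p : ℂ, |p.re - w.x| ≤ 2 * (level k).t + (level k).r →
      p.im = w.y + b.sign * (|p.re - w.x| - c) → p ∈ T

/-- A horizontal segment beyond the rectangle would miss the disks or be too high, so the curve
descends with slope 1 from the vertical diameters of the disks. For `b = Le` the factor `e = -1`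
turns the picture by a half turn. The hypothesis `hclear` keeps the other rectangles and disks away
from the tip, which is at most `2t + 1.9r` from the center of `w`. -/
theorem hasCrossing_wedge {k : ℕ} (hk : 1 ≤ k) {w : Word} (hw : w ∈ wordsOfLength k) (b : Side)
    (hclear : ∀ v ∈ wordsOfLength k,
      0 ≤ b.sign * (v.y - w.y) ∨ b.sign * (v.y - w.y) ≤ -(4 * (level k).r)) :
    HasCrossing (disk k w b.opp) (disk k w b) (WedgeBarrier k b w) := by
  obtain ⟨r1, r2, r3⟩ := level_regular k
  set K := level k with hK
  have hbb : b.sign * b.sign = 1 := by rcases b.sign_eq with h | h <;> rw [h] <;> norm_num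
  have hre : ∀ (e : Side) (c s : ℝ), e.sign * ((graphCurve ⟨w.x, w.y⟩ b.sign 1 c s).re - w.x) =
      e.sign * b.sign * s := fun e c s => by
    rw [(graphCurve_sign w.x w.y b.sign 1 c s).1]
    ring
  have him : ∀ c s : ℝ, (graphCurve ⟨w.x, w.y⟩ b.sign 1 c s).im - w.y = b.sign * (|s| + c) :=
    fun c s => by
    rw [(graphCurve_sign w.x w.y b.sign 1 c s).2]
    ring
  have hsq : ∀ c : ℝ, (b.sign * c) ^ 2 = c ^ 2 := fun c => by
    rw [mul_pow, pow_two b.sign, hbb, one_mul]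
  set R := 2 * K.t + K.r with hR
  -- `R` is the distance of the disk centers from the axis, so `R + c` is the offset of an endpoint
  -- along the vertical diameter. Over the rectangle, where `|s| ≤ t`, the bound `c ≤ -R` puts the
  -- curve at least `t + r` beyond the center.
  have hquad : ∀ c ∈ Icc (-(R + 9 / 10 * K.r)) (-R), (R + c) ^ 2 ≤ K.r ^ 2 := fun c hc =>
    sq_le_sq' (by linarith [hc.1]) (by linarith [hc.2])
  refine hasCrossing_of_graphCurve (z₀ := ⟨w.x, w.y⟩) (e := b.sign) (κ := 1)
    (p := -R) (q := R) (c₁ := -(R + 9 / 10 * K.r)) (c₂ := -R)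
    b.norm_sign (by linarith) (by linarith) (isClosed_disk _ _ _) (isClosed_disk _ _ _)
    (convex_disk _ _ _) (convex_disk _ _ _) (disjoint_disk_opp _ _ _) ?_ ?_ ?_ ?_ ?_ ?_ ?_
  · intro c hc
    rw [mem_disk_iff_sign_mul, hre, him, b.sign_opp, hsq, neg_mul, hbb, ← hK, ← hR, abs_neg,
      abs_of_nonneg (by linarith : 0 ≤ R)]
    linarith [hquad c hc]
  · intro c hc
    rw [mem_disk_iff_sign_mul, hre, him, hsq, hbb, ← hK, ← hR,
      abs_of_nonneg (by linarith : 0 ≤ R)]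
    linarith [hquad c hc]
  · intro c _ s _ h
    have h := (sign_mul_re_sub_of_mem_disk h).1
    rw [hre, b.sign_opp, neg_mul, hbb] at h
    linarith
  · intro c _ s _ h
    have h := (sign_mul_re_sub_of_mem_disk h).1
    rw [hre, hbb] at h
    linarith
  · intro c hc s hs hO
    have hx1 := (graphCurve_sign w.x w.y b.sign 1 c s).1
    have hy1 := him c s
    have hs0 : |s| ≤ R := abs_le.2 hs
    have hs1 := abs_nonneg s
    have hx2 : |(graphCurve ⟨w.x, w.y⟩ b.sign 1 c s).re - w.x| = |s| := by
      rw [hx1, add_sub_cancel_left]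
      rcases b.sign_eq with h | h <;> simp [h]
    set P := graphCurve ⟨w.x, w.y⟩ b.sign 1 c s
    obtain ⟨v, hv, hm, hmI, h⟩ := exists_of_mem_obstacle (p := P) hk hw (by linarith) hO
    have hy2 : |P.im - v.y| ≤ K.r := by
      rcases h with ⟨e, he⟩ | h
      exacts [(bounds_of_mem_disk he).2, h.2.2]
    obtain rfl : v = w := by
      by_contra hne
      have g : 2 * K.r + K.δ ≤ |v.y - w.y| := not_lt.1 fun hlt =>
          hne (Word.eq_of_abs_y_sub_lt hk hv hw hm hmI hlt)
      have hcl := hclear v hv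
      rw [le_abs] at g
      rw [abs_le] at hy2
      rcases b.sign_eq with h | h <;> rw [h] at hcl hy1 <;> rcases hcl with hcl | hcl <;>
        rcases g with g | g <;> linarith [hc.1, hc.2, hy2.1, hy2.2]
    rcases h with ⟨e, he⟩ | h
    · rcases b.eq_or_eq_opp e with rfl | rfl
      exacts [Or.inr he, Or.inl he]
    · exfalso
      have h1 := h.1
      rw [hx2, ← hK] at h1
      rw [abs_le] at hy2
      rcases b.sign_eq with h | h <;> rw [h] at hy1 <;> linarith [hc.2, hy2.1, hy2.2]
  · linarith
  · intro c hc T hT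
    refine ⟨-c, by linarith [hc.2], by linarith [hc.1], fun p hp1 hp2 => ?_⟩
    have h := hT (b.sign * (p.re - w.x)) ?_
    · convert h using 1
      apply Complex.ext
      · rw [(graphCurve_sign w.x w.y b.sign 1 c _).1, ← mul_assoc, hbb]
        ring
      · have habs : |b.sign * (p.re - w.x)| = |p.re - w.x| := by
          rcases b.sign_eq with h | h <;> rw [h] <;> simp [abs_sub_comm]
        rw [(graphCurve_sign w.x w.y b.sign 1 c _).2, hp2, habs]
        ring
    · rw [abs_le] at hp1
      rcases b.sign_eq with h | h <;> rw [h] <;> constructor <;> linarith [hp1.1, hp1.2]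

/-! ### Separation -/

/-- Off `T`, the sphere splits into the interior of `S`, which contains `z`, and the complement of
its closure, which is an open neighborhood of `∞` because `S` is bounded. -/
theorem separates_of_frontier_subset {S T : Set ℂ} {z : ℂ} (hz : z ∈ S) (hzT : z ∉ T)
    (hS : Bornology.IsBounded S) (hfr : frontier S ⊆ T) :
    Separates ((fun p : ℂ => (p : OnePoint ℂ)) '' T) (z : OnePoint ℂ) OnePoint.infty := by
  have hz' : (z : OnePoint ℂ) ∈ ((fun p : ℂ => (p : OnePoint ℂ)) '' T)ᶜ := by
    rintro ⟨p, hp, hpz⟩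
    exact hzT (OnePoint.coe_injective hpz ▸ hp)
  have hi : OnePoint.infty ∈ ((fun p : ℂ => (p : OnePoint ℂ)) '' T)ᶜ := by
    rintro ⟨p, -, hp⟩
    exact OnePoint.coe_ne_infty p hp
  refine ⟨hz', hi, fun heq => ?_⟩
  have hU : IsOpen ((fun p : ℂ => (p : OnePoint ℂ)) '' interior S) :=
    OnePoint.isOpen_image_coe.2 isOpen_interior
  have hV : IsOpen ((fun p : ℂ => (p : OnePoint ℂ)) '' closure S)ᶜ :=
    OnePoint.isOpen_compl_image_coe.2 ⟨isClosed_closure, hS.isCompact_closure⟩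
  have hdisj : Disjoint ((fun p : ℂ => (p : OnePoint ℂ)) '' interior S)
      ((fun p : ℂ => (p : OnePoint ℂ)) '' closure S)ᶜ :=
    disjoint_compl_right_iff_subset.2 (image_mono (interior_subset.trans subset_closure))
  have hzi : z ∈ interior S := by
    by_contra h
    exact hzT (hfr ⟨subset_closure hz, h⟩)
  have hcov : connectedComponentIn ((fun p : ℂ => (p : OnePoint ℂ)) '' T)ᶜ (z : OnePoint ℂ) ⊆
      ((fun p : ℂ => (p : OnePoint ℂ)) '' interior S) ∪
        ((fun p : ℂ => (p : OnePoint ℂ)) '' closure S)ᶜ := by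
    intro x hx
    by_cases hxc : x ∈ (fun p : ℂ => (p : OnePoint ℂ)) '' closure S
    · obtain ⟨p, hp, rfl⟩ := hxc
      refine Or.inl ⟨p, ?_, rfl⟩
      by_contra h
      exact connectedComponentIn_subset _ _ hx ⟨p, hfr ⟨hp, h⟩, rfl⟩
    · exact Or.inr hxc
  have hsub := isPreconnected_connectedComponentIn.subset_left_of_subset_union hU hV hdisj hcov
    ⟨z, mem_connectedComponentIn hz', z, hzi, rfl⟩
  have hmem : OnePoint.infty ∈
      connectedComponentIn ((fun p : ℂ => (p : OnePoint ℂ)) '' T)ᶜ (z : OnePoint ℂ) := by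
    rw [heq]
    exact mem_connectedComponentIn hi
  obtain ⟨p, -, hp⟩ := hsub hmem
  exact OnePoint.coe_ne_infty p hp

/-- The points on the left (`b = 1`) or on the right (`b = -1`) of a vertical line which jumps at
height `y₀` from abscissa `b * u` to abscissa `b * v`. -/
def stepSide (b y₀ u v : ℝ) : Set ℂ :=
  {p | (p.im ≤ y₀ ∧ b * p.re < u) ∨ (y₀ ≤ p.im ∧ b * p.re < v)}

theorem closure_stepSide_subset (b y₀ u v : ℝ) :
    closure (stepSide b y₀ u v) ⊆
      {p | (p.im ≤ y₀ ∧ b * p.re ≤ u) ∨ (y₀ ≤ p.im ∧ b * p.re ≤ v)} := by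
  refine closure_minimal ?_ ?_
  · rintro p (⟨h1, h2⟩ | ⟨h1, h2⟩)
    exacts [Or.inl ⟨h1, h2.le⟩, Or.inr ⟨h1, h2.le⟩]
  · exact ((isClosed_le Complex.continuous_im continuous_const).inter
      (isClosed_le (continuous_const.mul Complex.continuous_re) continuous_const)).union
      ((isClosed_le continuous_const Complex.continuous_im).inter
      (isClosed_le (continuous_const.mul Complex.continuous_re) continuous_const))

theorem frontier_stepSide_subset (b y₀ u v : ℝ) :
    frontier (stepSide b y₀ u v) ⊆
      {p | (p.im ≤ y₀ ∧ b * p.re = u) ∨ (y₀ ≤ p.im ∧ b * p.re = v) ∨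
        (p.im = y₀ ∧ min u v ≤ b * p.re ∧ b * p.re ≤ max u v)} := by
  rintro p ⟨hc, hi⟩
  have hcl := closure_stepSide_subset b y₀ u v hc
  have hre : Continuous fun q : ℂ => b * q.re := continuous_const.mul Complex.continuous_re
  have h1 : ¬ (p.im < y₀ ∧ b * p.re < u) := fun h => hi <| by
    refine mem_interior.2 ⟨{q : ℂ | q.im < y₀ ∧ b * q.re < u}, ?_, ?_, h⟩
    · exact fun q hq => Or.inl ⟨hq.1.le, hq.2⟩
    · exact (isOpen_lt Complex.continuous_im continuous_const).inter
        (isOpen_lt hre continuous_const)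
  have h2 : ¬ (y₀ < p.im ∧ b * p.re < v) := fun h => hi <| by
    refine mem_interior.2 ⟨{q : ℂ | y₀ < q.im ∧ b * q.re < v}, ?_, ?_, h⟩
    · exact fun q hq => Or.inr ⟨hq.1.le, hq.2⟩
    · exact (isOpen_lt continuous_const Complex.continuous_im).inter
        (isOpen_lt hre continuous_const)
  -- At the height of the jump, a point on the near side of both lines has a whole neighborhood in
  -- the set; this confines the horizontal part of the frontier to the jump.
  have h3 : ¬ (b * p.re < min u v) := fun h => hi <| by
    refine mem_interior.2 ⟨{q : ℂ | b * q.re < min u v}, ?_, ?_, h⟩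
    · intro q hq
      rcases le_total q.im y₀ with hy | hy
      · exact Or.inl ⟨hy, lt_of_lt_of_le hq (min_le_left _ _)⟩
      · exact Or.inr ⟨hy, lt_of_lt_of_le hq (min_le_right _ _)⟩
    · exact isOpen_lt hre continuous_const
  rcases lt_trichotomy p.im y₀ with hy | hy | hy
  · refine Or.inl ⟨hy.le, ?_⟩
    rcases hcl with h | h
    · exact le_antisymm h.2 (not_lt.1 fun h' => h1 ⟨hy, h'⟩)
    · linarith [h.1]
  · refine Or.inr (Or.inr ⟨hy, not_lt.1 h3, ?_⟩)
    rcases hcl with h | h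
    · exact h.2.trans (le_max_left _ _)
    · exact h.2.trans (le_max_right _ _)
  · refine Or.inr (Or.inl ⟨hy.le, ?_⟩)
    rcases hcl with h | h
    · linarith [h.1]
    · exact le_antisymm h.2 (not_lt.1 fun h' => h2 ⟨hy, h'⟩)

/-- A closed curve made of the graphs of `f` and `g` and of two vertical lines with a jump
separates the points inside from `∞`. The abscissas of the lines are `x₀ ± R` up to an error `η`. -/
theorem separates_of_barriers {T : Set ℂ} {z : ℂ} {f g : ℝ → ℝ} (hf : Continuous f)
    (hg : Continuous g) {B C : ℝ} (hfB : ∀ x, B ≤ f x) (hgC : ∀ x, g x ≤ C)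
    {x₀ y₀ R η : ℝ} {u v : Side → ℝ}
    (hu : ∀ b, |u b - R| ≤ η)
    (hv : ∀ b, |v b - R| ≤ η)
    (hzT : z ∉ T) (hzf : f z.re < z.im) (hzg : z.im < g z.re) (hzx : |z.re - x₀| < R - η)
    (hTf : ∀ p : ℂ, p.im = f p.re → |p.re - x₀| ≤ R + η → p ∈ T)
    (hTg : ∀ p : ℂ, p.im = g p.re → |p.re - x₀| ≤ R + η → p ∈ T)
    (hTu : ∀ b : Side, ∀ p : ℂ, b.sign * (p.re - x₀) = u b → f p.re ≤ p.im → p.im ≤ y₀ → p ∈ T)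
    (hTv : ∀ b : Side, ∀ p : ℂ, b.sign * (p.re - x₀) = v b → y₀ ≤ p.im → p.im ≤ g p.re → p ∈ T)
    (hTm : ∀ b : Side, ∀ p : ℂ, p.im = y₀ → |b.sign * (p.re - x₀) - R| ≤ η → p ∈ T) :
    Separates ((fun p : ℂ => (p : OnePoint ℂ)) '' T) (z : OnePoint ℂ) OnePoint.infty := by
  set Sf : Set ℂ := {p | f p.re < p.im} with hSf
  set Sg : Set ℂ := {p | p.im < g p.re} with hSg
  set Sr := stepSide 1 y₀ (x₀ + u Side.Ri) (x₀ + v Side.Ri) with hSr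
  set Sl := stepSide (-1) y₀ (-x₀ + u Side.Le) (-x₀ + v Side.Le) with hSl
  have hfc : Continuous fun p : ℂ => f p.re := hf.comp Complex.continuous_re
  have hgc : Continuous fun p : ℂ => g p.re := hg.comp Complex.continuous_re
  have hu1 := abs_le.1 (hu Side.Ri)
  have hv1 := abs_le.1 (hv Side.Ri)
  have hu2 := abs_le.1 (hu Side.Le)
  have hv2 := abs_le.1 (hv Side.Le)
  have clf : closure Sf ⊆ {p | f p.re ≤ p.im} :=
    closure_lt_subset_le hfc Complex.continuous_im
  have clg : closure Sg ⊆ {p | p.im ≤ g p.re} :=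
    closure_lt_subset_le Complex.continuous_im hgc
  have clx : ∀ p, p ∈ closure Sr → p ∈ closure Sl → |p.re - x₀| ≤ R + η := by
    intro p h1 h2
    have h1 := closure_stepSide_subset _ _ _ _ h1
    have h2 := closure_stepSide_subset _ _ _ _ h2
    simp only [mem_ofPred_eq] at h1 h2
    rw [abs_le]
    constructor
    · rcases h2 with h | h <;> linarith [h.2]
    · rcases h1 with h | h <;> linarith [h.2]
  -- A frontier point of a side lies on its lower line, on its upper line, or on the jump between
  -- them; the closures of `Sf` and `Sg` cut the lines off at the two graphs.
  have step : ∀ b : Side, ∀ p ∈ frontier (stepSide b.sign y₀ (b.sign * x₀ + u b)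
      (b.sign * x₀ + v b)), p ∈ closure Sf → p ∈ closure Sg → p ∈ T := by
    intro b p hp h1 h2
    have hub := abs_le.1 (hu b)
    have hvb := abs_le.1 (hv b)
    rcases frontier_stepSide_subset _ _ _ _ hp with h | h | h
    · exact hTu b p (by linarith [h.2]) (clf h1) h.1
    · exact hTv b p (by linarith [h.2]) h.1 (clg h2)
    · refine hTm b p h.1 ?_
      obtain ⟨-, h3, h4⟩ := h
      rw [abs_le]
      rcases min_le_iff.1 h3 with h3 | h3 <;> rcases le_max_iff.1 h4 with h4 | h4 <;>
        constructor <;> linarith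
  have hmem : z ∈ (Sf ∩ Sg) ∩ (Sr ∩ Sl) := by
    rw [abs_lt] at hzx
    refine ⟨⟨hzf, hzg⟩, ?_, ?_⟩
    · rcases le_total z.im y₀ with h | h
      · exact Or.inl ⟨h, by linarith⟩
      · exact Or.inr ⟨h, by linarith⟩
    · rcases le_total z.im y₀ with h | h
      · exact Or.inl ⟨h, by linarith⟩
      · exact Or.inr ⟨h, by linarith⟩
  refine separates_of_frontier_subset hmem hzT ?_ ?_
  · refine (Metric.isBounded_closedBall (x := (⟨x₀, 0⟩ : ℂ)) (r := (R + η) + (|B| + |C|))).subset ?_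
    rintro p ⟨⟨h1, h2⟩, h3, h4⟩
    have hx := clx p (subset_closure h3) (subset_closure h4)
    have h1 : f p.re < p.im := h1
    have h2 : p.im < g p.re := h2
    have hy : |p.im| ≤ |B| + |C| := by
      have := hfB p.re
      have := hgC p.re
      rw [abs_le]
      constructor
      · linarith [neg_abs_le B, abs_nonneg C]
      · linarith [le_abs_self C, abs_nonneg B]
    rw [Metric.mem_closedBall, dist_eq_norm]
    refine (Complex.norm_le_abs_re_add_abs_im _).trans (add_le_add ?_ ?_)
    · simpa using hx
    · simpa using hy
  · rintro p hp
    rcases frontier_inter_subset _ _ hp with ⟨h1, h2⟩ | ⟨h1, h2⟩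
    · have h2r := closure_mono inter_subset_left h2
      have h2l := closure_mono inter_subset_right h2
      have hx := clx p h2r h2l
      rcases frontier_inter_subset _ _ h1 with ⟨h3, -⟩ | ⟨-, h3⟩
      · exact hTf p (frontier_lt_subset_eq hfc Complex.continuous_im h3).symm hx
      · exact hTg p (frontier_lt_subset_eq Complex.continuous_im hgc h3) hx
    · have h1f := closure_mono inter_subset_left h1
      have h1g := closure_mono inter_subset_right h1
      rcases frontier_inter_subset _ _ h2 with ⟨h3, -⟩ | ⟨-, h3⟩
      · exact step Side.Ri p (by simpa [Side.sign] using h3) h1f h1g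
      · exact step Side.Le p (by simpa [Side.sign] using h3) h1f h1g

/-! ### From barriers to separation -/

/-- `T` contains the part near the column of `v` of the graph of a function, which is above
(`β = 1`) or below (`β = -1`) the part of height between `y - r` and `y + r` of the thin central
strip of the column. -/
def EndBarrier (k : ℕ) (v : Word) (β y : ℝ) (T : Set ℂ) : Prop :=
  ∃ (f : ℝ → ℝ) (C : ℝ), Continuous f ∧ (∀ x, β * f x ≤ C) ∧
    (∀ p : ℂ, p.im = f p.re →
      |p.re - v.x| ≤ 2 * (level k).t + (level k).r + (level k).δ / 2 → p ∈ T) ∧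
    (∀ x, 2 * (level k).t + (level k).r - (level k).δ / 2 ≤ |x - v.x| →
      β * (f x - v.y) ≤ (level k).r - (level k).δ) ∧
    ∀ x, |x - v.x| ≤ (level k).t → (level k).r < β * (f x - y)

theorem mem_of_mem_disk_Le_or_Ri {k : ℕ} {v : Word} {T : Set ℂ} (hT : ∀ b, disk k v b ⊆ T) {p : ℂ}
    (h : (|p.re - v.x| - (2 * (level k).t + (level k).r)) ^ 2 + (p.im - v.y) ^ 2 ≤
      (level k).r ^ 2) : p ∈ T := by
  rcases le_total 0 (p.re - v.x) with h0 | h0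
  · refine hT Side.Ri (mem_disk_iff_sign_mul.2 ?_)
    rw [abs_of_nonneg h0] at h
    simpa [Side.sign] using h
  · refine hT Side.Le (mem_disk_iff_sign_mul.2 ?_)
    rw [abs_of_nonpos h0] at h
    simpa [Side.sign] using h

theorem GapBarrier.endBarrier {k : ℕ} {v : Word} {T : Set ℂ} (h : GapBarrier k v T)
    (hT : ∀ b, disk k v b ⊆ T) {β y : ℝ} (hβ : β = 1 ∨ β = -1)
    (hy : 2 * (level k).r ≤ β * (v.y - y)) : EndBarrier k v β y T := by
  obtain ⟨r1, r2, r3⟩ := level_regular k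
  obtain ⟨c, hc, hcov⟩ := h
  rw [abs_le] at hc
  refine ⟨fun _ => v.y + c, β * (v.y + c), continuous_const, fun _ => le_rfl, ?_, ?_, ?_⟩
  · intro p hp hx
    -- Beyond the segment supplied by the gap, the horizontal line is within `r - δ` horizontally
    -- and `δ / 4` vertically of a disk center.
    by_cases h : |p.re - v.x| ≤ 2 * (level k).t + (level k).δ
    · exact hcov p h hp
    · refine mem_of_mem_disk_Le_or_Ri hT ?_
      rw [hp, add_sub_cancel_left]
      have h1 : (|p.re - v.x| - (2 * (level k).t + (level k).r)) ^ 2 ≤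
          ((level k).r - (level k).δ) ^ 2 := sq_le_sq' (by linarith) (by linarith)
      have h2 : c ^ 2 ≤ ((level k).δ / 4) ^ 2 := sq_le_sq' hc.1 hc.2
      nlinarith
  · intro x _
    rcases hβ with h | h <;> rw [h] <;> linarith [hc.1, hc.2]
  · intro x _
    rcases hβ with h | h <;> rw [h] at hy ⊢ <;> linarith [hc.1, hc.2]

theorem WedgeBarrier.endBarrier {k : ℕ} {b : Side} {w : Word} {T : Set ℂ}
    (h : WedgeBarrier k b w T) (hT : ∀ b, disk k w b ⊆ T) :
    EndBarrier k w (-b.sign) w.y T := by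
  obtain ⟨r1, r2, r3⟩ := level_regular k
  obtain ⟨c, hc1, hc2, hcov⟩ := h
  have hbb : b.sign * b.sign = 1 := by rcases b.sign_eq with h | h <;> rw [h] <;> norm_num
  have hf : ∀ x, -b.sign * (w.y + b.sign * (|x - w.x| - c) - w.y) = c - |x - w.x| := fun x => by
    linear_combination (c - |x - w.x|) * hbb
  refine ⟨fun x => w.y + b.sign * (|x - w.x| - c), -b.sign * w.y + c, by fun_prop, ?_, ?_, ?_, ?_⟩
  · intro x
    have := hf x
    have := abs_nonneg (x - w.x)
    linarith
  · intro p hp hx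
    by_cases h : |p.re - w.x| ≤ 2 * (level k).t + (level k).r
    · exact hcov p h hp
    · refine mem_of_mem_disk_Le_or_Ri hT ?_
      rw [hp, add_sub_cancel_left, mul_pow, pow_two b.sign, hbb, one_mul]
      -- Past the vertical diameter the graph is continued inside the disk; the factor 9/10 leaves
      -- room for the horizontal error `δ / 2`.
      have h1 : (|p.re - w.x| - (2 * (level k).t + (level k).r)) ^ 2 ≤
          ((level k).δ / 2) ^ 2 := sq_le_sq' (by linarith) (by linarith)
      have h2 : (|p.re - w.x| - c) ^ 2 ≤ (9 / 10 * (level k).r) ^ 2 :=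
        sq_le_sq' (by linarith) (by linarith)
      nlinarith
  · intro x hx
    simp only [hf]
    linarith
  · intro x hx
    simp only [hf]
    linarith

/-- The vertical segment is at most `δ / 2` off the line of centers, so both disks contain its
continuation up to height `r - δ` beyond their centers. This is the height to which an `EndBarrier`
is guaranteed to meet it. -/
theorem SideBarrier.extend {k : ℕ} {b : Side} {v v' : Word} {y : ℝ} {T : Set ℂ}
    (h : SideBarrier k b v.x y T) (hv : v.y = y - ((level k).r + (level k).δ / 2))
    (hv' : v'.y = y + ((level k).r + (level k).δ / 2)) (hx : v'.x = v.x)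
    (hT : disk k v b ⊆ T) (hT' : disk k v' b ⊆ T) :
    ∃ u, |u - (2 * (level k).t + (level k).r)| ≤ (level k).δ / 2 ∧
      ∀ p : ℂ, b.sign * (p.re - v.x) = u → v.y - ((level k).r - (level k).δ) ≤ p.im →
        p.im ≤ v'.y + ((level k).r - (level k).δ) → p ∈ T := by
  obtain ⟨r1, r2, r3⟩ := level_regular k
  obtain ⟨u, hu, hcov⟩ := h
  refine ⟨u, hu, fun p hp h1 h2 => ?_⟩
  have hquad : ∀ a : ℝ, |a| ≤ (level k).r - (level k).δ →
      (u - (2 * (level k).t + (level k).r)) ^ 2 + a ^ 2 ≤ (level k).r ^ 2 := by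
    intro a ha
    have e1 := sq_le_sq' (abs_le.1 hu).1 (abs_le.1 hu).2
    have e2 := sq_le_sq' (abs_le.1 ha).1 (abs_le.1 ha).2
    nlinarith
  by_cases h3 : p.im ≤ v.y + ((level k).r - (level k).δ)
  · refine hT (mem_disk_iff_sign_mul.2 ?_)
    rw [hp]
    exact hquad _ (abs_le.2 ⟨by linarith, by linarith⟩)
  by_cases h4 : v'.y - ((level k).r - (level k).δ) ≤ p.im
  · refine hT' (mem_disk_iff_sign_mul.2 ?_)
    rw [hx, hp]
    exact hquad _ (abs_le.2 ⟨by linarith, by linarith⟩)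
  exact hcov p hp (abs_le.2 ⟨by linarith, by linarith⟩)

theorem separates_of_endBarriers {k : ℕ} {w v v' : Word} {T : Set ℂ} {z : ℂ} (hz : z ∈ rect k w)
    (hzT : z ∉ T) (hvx : v.x = w.x) (hvx' : v'.x = w.x) (hT : ∀ b, disk k w b ⊆ T)
    (hlow : EndBarrier k v (-1) w.y T) (hupp : EndBarrier k v' 1 w.y T)
    (hside : ∀ b : Side,
      (∃ u, |u - (2 * (level k).t + (level k).r)| ≤ (level k).δ / 2 ∧
        ∀ p : ℂ, b.sign * (p.re - w.x) = u → v.y - ((level k).r - (level k).δ) ≤ p.im →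
          p.im ≤ w.y → p ∈ T) ∧
      (∃ u, |u - (2 * (level k).t + (level k).r)| ≤ (level k).δ / 2 ∧
        ∀ p : ℂ, b.sign * (p.re - w.x) = u → w.y ≤ p.im →
          p.im ≤ v'.y + ((level k).r - (level k).δ) → p ∈ T)) :
    Separates ((fun p : ℂ => (p : OnePoint ℂ)) '' T) (z : OnePoint ℂ) OnePoint.infty := by
  obtain ⟨r1, r2, r3⟩ := level_regular k
  obtain ⟨f, C, hf, hfC, hTf, hfend, hfz⟩ := hlow
  obtain ⟨g, C', hg, hgC, hTg, hgend, hgz⟩ := hupp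
  rw [hvx] at hTf hfend hfz
  rw [hvx'] at hTg hgend hgz
  choose u hu hTu using fun b => (hside b).1
  choose u' hu' hTu' using fun b => (hside b).2
  have hz1 : z.re ∈ Icc _ _ := hz.1
  have hz2 : z.im ∈ Icc _ _ := hz.2
  have hzx : |z.re - w.x| ≤ (level k).t := abs_le.2 ⟨by linarith [hz1.1], by linarith [hz1.2]⟩
  have hside_re : ∀ b : Side, ∀ p : ℂ, ∀ a, b.sign * (p.re - w.x) = a →
      |a - (2 * (level k).t + (level k).r)| ≤ (level k).δ / 2 →
      2 * (level k).t + (level k).r - (level k).δ / 2 ≤ |p.re - w.x| := by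
    intro b p a hp ha
    rw [abs_le] at ha
    rw [le_abs]
    rcases b.sign_eq with h | h <;> rw [h] at hp
    · left
      linarith
    · right
      linarith
  refine separates_of_barriers (f := f) (g := g) (B := -C) (C := C') (x₀ := w.x) (y₀ := w.y)
    (R := 2 * (level k).t + (level k).r) (η := (level k).δ / 2) (u := u) (v := u') hf hg
    (fun x => by linarith [hfC x]) (fun x => by linarith [hgC x]) hu hu' hzT ?_ ?_ ?_ hTf hTg
    ?_ ?_ ?_
  · linarith [hfz _ hzx, hz2.1]
  · linarith [hgz _ hzx, hz2.2]
  · linarith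
  · intro b p hp h1 h2
    have := hfend p.re (hside_re b p _ hp (hu b))
    exact hTu b p hp (by linarith) h2
  · intro b p hp h1 h2
    have := hgend p.re (hside_re b p _ hp (hu' b))
    exact hTu' b p hp h1 (by linarith)
  · intro b p hp h
    refine hT b (mem_disk_iff_sign_mul.2 ?_)
    rw [hp, sub_self]
    have := sq_le_sq' (abs_le.1 h).1 (abs_le.1 h).2
    nlinarith

/-! ### Neighbors -/

theorem one_le_n_le_N {k : ℕ} (hk : 1 ≤ k) {w : Word} (hw : w ∈ wordsOfLength k) :
    1 ≤ w.n ∧ w.n ≤ (level k).N := by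
  obtain ⟨k, rfl⟩ := Nat.exists_eq_add_of_le' hk
  obtain ⟨-, n, l, h, -, h1⟩ := hw
  simp only [List.cons.injEq] at h
  rwa [h.1]

theorem shift_mem_wordsOfLength {k : ℕ} (hk : 1 ≤ k) {w : Word} (hw : w ∈ wordsOfLength k) {i : ℤ}
    (h1 : 1 ≤ w.n + i) (h2 : w.n + i ≤ (level k).N) : w.shift i ∈ wordsOfLength k := by
  obtain ⟨k, rfl⟩ := Nat.exists_eq_add_of_le' hk
  obtain ⟨h0, n, l, h, hl, -⟩ := hw
  simp only [List.cons.injEq] at h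
  exact ⟨h0, w.n + i, l, by rw [← h.2]; rfl, hl, h1, h2⟩

theorem exists_level_N_eq {k : ℕ} (hk : 2 ≤ k) : ∃ M : ℤ, 100 ≤ M ∧ (level k).N = 2 * M := by
  obtain ⟨k, rfl⟩ := Nat.exists_eq_add_of_le' (show 1 ≤ k by omega)
  obtain ⟨M, hM⟩ := exists_isRefinement (show 1 ≤ k by omega)
  exact ⟨M, hM.le_M, hM.N_eq⟩

/-- On levels above the first, the letter `N / 2` is excluded because its successor lies across the
middle gap of the parent; level one is a single building block. -/
theorem shift_one_y {k : ℕ} (hk : 1 ≤ k) {w : Word} (hw : w ∈ wordsOfLength k)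
    (hn : k = 1 ∨ w.n ≠ (level k).N / 2) :
    (w.shift 1).y = w.y + 2 * ((level k).r + (level k).δ / 2) := by
  rcases hk.eq_or_lt with rfl | hk2
  · obtain ⟨-, n, l, h, hl, -⟩ := hw
    obtain rfl : l = [] := hl
    simp only [List.cons.injEq] at h
    have e1 : (w.shift 1).y = yWord [w.n + 1] := by
      rw [← h.2]
      rfl
    have e2 : w.y = yWord [w.n] := by
      rw [← h.2]
      rfl
    rw [e1, e2, yWord_singleton, yWord_singleton]
    push_cast
    ring
  · obtain ⟨k, rfl⟩ := Nat.exists_eq_add_of_le' hk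
    have hk1 : 1 ≤ k := by omega
    obtain ⟨M, hM⟩ := exists_isRefinement hk1
    have hN := hM.N_eq
    obtain ⟨u, hu, -, hn', -⟩ := exists_parent hk1 hw
    have hlen : w.nInit.length = k := by
      rw [hn']
      exact length_of_mem_nWords hu.2
    have e1 : (w.shift 1).y = yWord ((w.n + 1) :: w.nInit) := rfl
    have e2 : w.y = yWord (w.n :: w.nInit) := rfl
    rw [e1, e2]
    rcases le_or_gt (w.n + 1) M with h | h
    · rw [yWord_cons_lower hk1 hM hlen h, yWord_cons_lower hk1 hM hlen (by omega)]
      push_cast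
      ring
    · rw [yWord_cons_upper hk1 hM hlen h, yWord_cons_upper hk1 hM hlen (by omega)]
      push_cast
      ring

/-- Beyond the end of a block comes a gap of the parent level, of length δ_{k-1} ≥ 20000 r_k, or, at
level one, nothing at all. -/
theorem clear_beyond_end {k : ℕ} (hk : 1 ≤ k) {w : Word} (hw : w ∈ wordsOfLength k) (b : Side)
    (hend : (k = 1 ∧ ∀ n : ℤ, 1 ≤ n → n ≤ 2 → 0 ≤ b.sign * ((n : ℝ) - w.n)) ∨
      (2 ≤ k ∧ ∀ n : ℤ, 1 ≤ n → n ≤ (level k).N →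
        (w.n ≤ (level k).N / 2 ↔ n ≤ (level k).N / 2) → 0 ≤ b.sign * ((n : ℝ) - w.n)))
    {v : Word} (hv : v ∈ wordsOfLength k) :
    0 ≤ b.sign * (v.y - w.y) ∨ b.sign * (v.y - w.y) ≤ -(4 * (level k).r) := by
  obtain ⟨r1, r2, r3⟩ := level_regular k
  have hd : 0 ≤ 2 * (level k).r + (level k).δ := by linarith
  rcases hend with ⟨rfl, hend⟩ | ⟨hk2, hend⟩
  · left
    obtain ⟨-, n, l, h, hl, -⟩ := hw
    obtain rfl : l = [] := hl
    obtain ⟨-, n', l', h', hl', hn1, hn2⟩ := hv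
    obtain rfl : l' = [] := hl'
    simp only [List.cons.injEq] at h h'
    have e1 : v.y = yWord [v.n] := by
      rw [← h'.2]
      rfl
    have e2 : w.y = yWord [w.n] := by
      rw [← h.2]
      rfl
    rw [← h'.1] at hn1 hn2
    have := mul_nonneg (hend v.n hn1 hn2) hd
    rw [e1, e2, yWord_singleton, yWord_singleton]
    linarith
  · obtain ⟨k, rfl⟩ := Nat.exists_eq_add_of_le' hk
    have hk1 : 1 ≤ k := by omega
    obtain ⟨M, hM⟩ := exists_isRefinement hk1
    have hN : (level (k + 1)).N / 2 = M := by have := hM.N_eq; omega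
    rw [hN] at hend
    obtain ⟨u, hu, -, hun, h1, h2⟩ := exists_parent hk1 hw
    obtain ⟨u', hu', -, hun', h1', h2'⟩ := exists_parent hk1 hv
    have hl : w.nInit ∈ nWords k := hun ▸ hu.2
    have hl' : v.nInit ∈ nWords k := hun' ▸ hu'.2
    have hp := level_regular k
    rcases yWord_cons_gap hk1 hM (length_of_mem_nWords hl') (length_of_mem_nWords hl)
      (fun h => le_abs_yWord_sub hk1 hl' hl h) h1' h2' h1 h2 with h | ⟨-, hiff, h⟩
    · have h : 2 * (level (k + 1)).r + (level k).δ ≤ |v.y - w.y| := h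
      have e1 := hM.r_le
      have e2 := hp.t_le
      have e3 := hp.t_pos
      rw [le_abs] at h
      rcases b.sign_eq with hb | hb <;> rw [hb] <;> rcases h with h | h
      · left
        linarith
      · right
        linarith
      · right
        linarith
      · left
        linarith
    · left
      have h : v.y - w.y = _ := h
      rw [h, ← mul_assoc]
      exact mul_nonneg (hend v.n h1' h2' hiff.symm) hd

theorem Word.shift_neg_one_shift_one {w : Word} : (w.shift (-1)).shift 1 = w := by
  simp [Word.shift]

theorem notMem_disk_of_mem_rect {k : ℕ} {w v : Word} (hx : v.x = w.x) {z : ℂ} (hz : z ∈ rect k w)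
    (b : Side) : z ∉ disk k v b := by
  intro h
  have hz1 : z.re ∈ Icc _ _ := hz.1
  have h := (sign_mul_re_sub_of_mem_disk h).1
  have := (level_regular k).t_pos
  rw [hx] at h
  rcases b.sign_eq with hb | hb <;> rw [hb] at h <;> linarith [hz1.1, hz1.2]

theorem PlanePath.Connects.notMem_trace {γ : PlanePath} {A B : Set ℂ}
    (h : γ.Connects A B OmegaFinite) {z : ℂ} (hz : z ∈ cantorProduct) (hA : z ∉ A) (hB : z ∉ B) :
    z ∉ γ.trace := by
  rintro ⟨t, ht, rfl⟩
  obtain ⟨-, h1, h2, h3⟩ := h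
  rcases ht.1.eq_or_lt with rfl | h4
  · exact hA h1
  rcases ht.2.eq_or_lt with rfl | h5
  · exact hB h2
  · exact h3 t ⟨h4, h5⟩ ⟨_, Or.inr hz, rfl⟩

/-- The conclusion of the main theorem for a cyclic list of sets. -/
def SeparatingFamilies (z : ℂ) (l : List (Set ℂ)) : Prop :=
  ∃ Γ : Fin l.length → Set PlanePath,
    (∀ j, ∀ γ ∈ Γ j, γ.Connects (l.get j) (l.get (finRotate _ j)) OmegaFinite) ∧
    (∀ j, 1 / 10 ≤ conformalModulus (Γ j)) ∧
    ∀ γ : Fin l.length → PlanePath, (∀ j, γ j ∈ Γ j) →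
      Separates ((fun p : ℂ => (p : OnePoint ℂ)) '' ⋃ j, (γ j).trace ∪ l.get j)
        (z : OnePoint ℂ) OnePoint.infty

/-- Reduces the claim to geometry: any set that avoids `z`, contains the neighbors and has all the
barrier properties must separate. Monotonicity of `P` carries each property from a single path with
its two disks to the whole union. -/
theorem SeparatingFamilies.of_hasCrossing {z : ℂ} (hz : z ∈ cantorProduct) {l : List (Set ℂ)}
    (hzl : ∀ j, z ∉ l.get j) {P : Fin l.length → Set ℂ → Prop}
    (hP : ∀ j T T', T ⊆ T' → P j T → P j T')
    (h : ∀ j, HasCrossing (l.get j) (l.get (finRotate _ j)) (P j))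
    (hsep : ∀ T, z ∉ T → (∀ j, l.get j ⊆ T) → (∀ j, P j T) →
      Separates ((fun p : ℂ => (p : OnePoint ℂ)) '' T) (z : OnePoint ℂ) OnePoint.infty) :
    SeparatingFamilies z l := by
  choose Γ h1 h2 h3 using h
  refine ⟨Γ, h1, h2, fun γ hγ => hsep _ ?_ ?_ ?_⟩
  · rw [mem_iUnion]
    rintro ⟨j, hj | hj⟩
    · exact (h1 j _ (hγ j)).notMem_trace hz (hzl _) (hzl _) hj
    · exact hzl j hj
  · exact fun j => subset_iUnion_of_subset j subset_union_right
  · refine fun j => hP j _ _ ?_ (h3 j _ (hγ j))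
    refine union_subset (union_subset ?_ ?_) ?_
    · exact subset_iUnion_of_subset j subset_union_left
    · exact subset_iUnion_of_subset j subset_union_right
    · exact subset_iUnion_of_subset (finRotate _ j) subset_union_right

theorem GapBarrier.mono {k : ℕ} {v : Word} {T T' : Set ℂ} (h : T ⊆ T') (hT : GapBarrier k v T) :
    GapBarrier k v T' := by
  obtain ⟨c, hc, hcov⟩ := hT
  exact ⟨c, hc, fun p h1 h2 => h (hcov p h1 h2)⟩

theorem SideBarrier.mono {k : ℕ} {b : Side} {x y : ℝ} {T T' : Set ℂ} (h : T ⊆ T')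
    (hT : SideBarrier k b x y T) : SideBarrier k b x y T' := by
  obtain ⟨c, hc, hcov⟩ := hT
  exact ⟨c, hc, fun p h1 h2 => h (hcov p h1 h2)⟩

theorem WedgeBarrier.mono {k : ℕ} {b : Side} {w : Word} {T T' : Set ℂ} (h : T ⊆ T')
    (hT : WedgeBarrier k b w T) : WedgeBarrier k b w T' := by
  obtain ⟨c, hc, hc', hcov⟩ := hT
  exact ⟨c, hc, hc', fun p h1 h2 => h (hcov p h1 h2)⟩

/-- The word `w + 1` exists and its rectangle is separated from the one of `w` by one gap. -/
def HasSuccessor (k : ℕ) (w : Word) : Prop :=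
  w ∈ wordsOfLength k ∧ w.shift 1 ∈ wordsOfLength k ∧
    (w.shift 1).y = w.y + 2 * ((level k).r + (level k).δ / 2)

theorem HasSuccessor.hasCrossing_up {k : ℕ} (hk : 1 ≤ k) {w : Word} (h : HasSuccessor k w)
    (b : Side) : HasCrossing (disk k w b) (disk k (w.shift 1) b)
      (SideBarrier k b w.x (w.y + ((level k).r + (level k).δ / 2))) :=
  hasCrossing_side hk h.1 h.2.1 rfl rfl b (Or.inl rfl) (by ring) (by rw [h.2.2]; ring)

theorem HasSuccessor.hasCrossing_down {k : ℕ} (hk : 1 ≤ k) {w : Word} (h : HasSuccessor k w)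
    (b : Side) : HasCrossing (disk k (w.shift 1) b) (disk k w b)
      (SideBarrier k b w.x (w.y + ((level k).r + (level k).δ / 2))) :=
  hasCrossing_side hk h.2.1 h.1 rfl rfl b (Or.inr rfl) (by rw [h.2.2]; ring) (by ring)

theorem HasSuccessor.extend {k : ℕ} {w : Word} (h : HasSuccessor k w) {b : Side} {T : Set ℂ}
    (hS : SideBarrier k b w.x (w.y + ((level k).r + (level k).δ / 2)) T)
    (hT : disk k w b ⊆ T) (hT' : disk k (w.shift 1) b ⊆ T) :
    ∃ u, |u - (2 * (level k).t + (level k).r)| ≤ (level k).δ / 2 ∧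
      ∀ p : ℂ, b.sign * (p.re - w.x) = u → w.y - ((level k).r - (level k).δ) ≤ p.im →
        p.im ≤ (w.shift 1).y + ((level k).r - (level k).δ) → p ∈ T :=
  SideBarrier.extend (v := w) (v' := w.shift 1) hS (by ring) (by rw [h.2.2]; ring) rfl hT hT'

/-! ### Closing the curve in the bottom, top and middle positions -/

theorem separatingFamilies_bottom {k : ℕ} (hk : 1 ≤ k) {w : Word} (hs : HasSuccessor k w)
    (hclear : ∀ v ∈ wordsOfLength k, 0 ≤ Side.Ri.sign * (v.y - w.y) ∨
      Side.Ri.sign * (v.y - w.y) ≤ -(4 * (level k).r))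
    {z : ℂ} (hz : z ∈ cantorProduct) (hzw : z ∈ rect k w) :
    SeparatingFamilies z [disk k w .Ri, disk k (w.shift 1) .Ri, disk k (w.shift 1) .Le,
      disk k w .Le] := by
  obtain ⟨r1, r2, r3⟩ := level_regular k
  have hx : (w.shift 1).x = w.x := rfl
  have hy := hs.2.2
  refine .of_hasCrossing hz ?_ (P := ![
    SideBarrier k .Ri w.x (w.y + ((level k).r + (level k).δ / 2)), GapBarrier k (w.shift 1),
    SideBarrier k .Le w.x (w.y + ((level k).r + (level k).δ / 2)), WedgeBarrier k .Ri w])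
    ?_ ?_ ?_
  · intro j
    fin_cases j
    exacts [notMem_disk_of_mem_rect rfl hzw _, notMem_disk_of_mem_rect hx hzw _,
      notMem_disk_of_mem_rect hx hzw _, notMem_disk_of_mem_rect rfl hzw _]
  · intro j T T' h
    fin_cases j
    exacts [SideBarrier.mono h, GapBarrier.mono h, SideBarrier.mono h, WedgeBarrier.mono h]
  · intro j
    fin_cases j
    exacts [hs.hasCrossing_up hk .Ri, hasCrossing_gap hk hs.2.1 .Le, hs.hasCrossing_down hk .Le,
      hasCrossing_wedge hk hs.1 .Ri hclear]
  · intro T hzT hD hP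
    have d1 : disk k w .Ri ⊆ T := hD 0
    have d2 : disk k (w.shift 1) .Ri ⊆ T := hD 1
    have d3 : disk k (w.shift 1) .Le ⊆ T := hD 2
    have d4 : disk k w .Le ⊆ T := hD 3
    have hw : ∀ b, disk k w b ⊆ T := fun b => by cases b <;> assumption
    have hw1 : ∀ b, disk k (w.shift 1) b ⊆ T := fun b => by cases b <;> assumption
    have hside : ∀ b, SideBarrier k b w.x (w.y + ((level k).r + (level k).δ / 2)) T := by
      intro b
      cases b
      exacts [hP 2, hP 0]
    have hgap : GapBarrier k (w.shift 1) T := hP 1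
    have hwedge : WedgeBarrier k .Ri w T := hP 3
    refine separates_of_endBarriers (v := w) (v' := w.shift 1) hzw hzT rfl hx hw
      (hwedge.endBarrier hw) (hgap.endBarrier hw1 (Or.inl rfl) (by linarith)) fun b => ?_
    -- The wedge starts from the disks of `w` themselves, so one vertical line per side serves both
    -- above and below the height of `w`, and no jump occurs.
    obtain ⟨u, hu, hcov⟩ := hs.extend (hside b) (hw b) (hw1 b)
    exact ⟨⟨u, hu, fun p hp h1 h2 => hcov p hp h1 (by linarith)⟩,
      ⟨u, hu, fun p hp h1 h2 => hcov p hp (by linarith) h2⟩⟩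

theorem separatingFamilies_top {k : ℕ} (hk : 1 ≤ k) {w₀ w : Word} (hs : HasSuccessor k w₀)
    (hw₀ : w₀.shift 1 = w)
    (hclear : ∀ v ∈ wordsOfLength k, 0 ≤ Side.Le.sign * (v.y - w.y) ∨
      Side.Le.sign * (v.y - w.y) ≤ -(4 * (level k).r))
    {z : ℂ} (hz : z ∈ cantorProduct) (hzw : z ∈ rect k w) :
    SeparatingFamilies z [disk k w₀ .Ri, disk k w .Ri, disk k w .Le, disk k w₀ .Le] := by
  subst hw₀
  obtain ⟨r1, r2, r3⟩ := level_regular k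
  have hx : w₀.x = (w₀.shift 1).x := rfl
  have hy := hs.2.2
  refine .of_hasCrossing hz ?_ (P := ![
    SideBarrier k .Ri w₀.x (w₀.y + ((level k).r + (level k).δ / 2)),
    WedgeBarrier k .Le (w₀.shift 1),
    SideBarrier k .Le w₀.x (w₀.y + ((level k).r + (level k).δ / 2)), GapBarrier k w₀]) ?_ ?_ ?_
  · intro j
    fin_cases j
    exacts [notMem_disk_of_mem_rect hx hzw _, notMem_disk_of_mem_rect rfl hzw _,
      notMem_disk_of_mem_rect rfl hzw _, notMem_disk_of_mem_rect hx hzw _]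
  · intro j T T' h
    fin_cases j
    exacts [SideBarrier.mono h, WedgeBarrier.mono h, SideBarrier.mono h, GapBarrier.mono h]
  · intro j
    fin_cases j
    exacts [hs.hasCrossing_up hk .Ri, hasCrossing_wedge hk hs.2.1 .Le hclear,
      hs.hasCrossing_down hk .Le, hasCrossing_gap hk hs.1 .Ri]
  · intro T hzT hD hP
    have d1 : disk k w₀ .Ri ⊆ T := hD 0
    have d2 : disk k (w₀.shift 1) .Ri ⊆ T := hD 1
    have d3 : disk k (w₀.shift 1) .Le ⊆ T := hD 2
    have d4 : disk k w₀ .Le ⊆ T := hD 3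
    have hw : ∀ b, disk k w₀ b ⊆ T := fun b => by cases b <;> assumption
    have hw1 : ∀ b, disk k (w₀.shift 1) b ⊆ T := fun b => by cases b <;> assumption
    have hside : ∀ b, SideBarrier k b w₀.x (w₀.y + ((level k).r + (level k).δ / 2)) T := by
      intro b
      cases b
      exacts [hP 2, hP 0]
    have hgap : GapBarrier k w₀ T := hP 3
    have hwedge : WedgeBarrier k .Le (w₀.shift 1) T := hP 1
    refine separates_of_endBarriers (v := w₀) (v' := w₀.shift 1) hzw hzT hx rfl hw1
      (hgap.endBarrier hw (Or.inr rfl) (by linarith))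
      (by simpa [Side.sign] using hwedge.endBarrier hw1) fun b => ?_
    obtain ⟨u, hu, hcov⟩ := hs.extend (hside b) (hw b) (hw1 b)
    exact ⟨⟨u, hu, fun p hp h1 h2 => hcov p hp h1 (by linarith)⟩,
      ⟨u, hu, fun p hp h1 h2 => hcov p hp (by linarith) h2⟩⟩

theorem separatingFamilies_middle {k : ℕ} (hk : 1 ≤ k) {w₀ w : Word} (hs₀ : HasSuccessor k w₀)
    (hw₀ : w₀.shift 1 = w) (hs : HasSuccessor k w) {z : ℂ} (hz : z ∈ cantorProduct)
    (hzw : z ∈ rect k w) :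
    SeparatingFamilies z [disk k w₀ .Ri, disk k w .Ri, disk k (w.shift 1) .Ri,
      disk k (w.shift 1) .Le, disk k w .Le, disk k w₀ .Le] := by
  obtain ⟨r1, r2, r3⟩ := level_regular k
  have hx : (w.shift 1).x = w.x := rfl
  have hx₀ : w₀.x = w.x := by rw [← hw₀]; rfl
  have hy := hs.2.2
  have hy₀ := hs₀.2.2
  have hup := hs₀.hasCrossing_up hk .Ri
  have hdown := hs₀.hasCrossing_down hk .Le
  have hext : ∀ b T, _ := fun b T => hs₀.extend (b := b) (T := T)
  rw [hw₀] at hy₀ hup hdown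
  simp only [hw₀] at hext
  refine .of_hasCrossing hz ?_ (P := ![
    SideBarrier k .Ri w₀.x (w₀.y + ((level k).r + (level k).δ / 2)),
    SideBarrier k .Ri w.x (w.y + ((level k).r + (level k).δ / 2)), GapBarrier k (w.shift 1),
    SideBarrier k .Le w.x (w.y + ((level k).r + (level k).δ / 2)),
    SideBarrier k .Le w₀.x (w₀.y + ((level k).r + (level k).δ / 2)), GapBarrier k w₀]) ?_ ?_ ?_
  · intro j
    fin_cases j
    exacts [notMem_disk_of_mem_rect hx₀ hzw _, notMem_disk_of_mem_rect rfl hzw _,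
      notMem_disk_of_mem_rect hx hzw _, notMem_disk_of_mem_rect hx hzw _,
      notMem_disk_of_mem_rect rfl hzw _, notMem_disk_of_mem_rect hx₀ hzw _]
  · intro j T T' h
    fin_cases j
    exacts [SideBarrier.mono h, SideBarrier.mono h, GapBarrier.mono h, SideBarrier.mono h,
      SideBarrier.mono h, GapBarrier.mono h]
  · intro j
    fin_cases j
    exacts [hup, hs.hasCrossing_up hk .Ri, hasCrossing_gap hk hs.2.1 .Le,
      hs.hasCrossing_down hk .Le, hdown, hasCrossing_gap hk hs₀.1 .Ri]
  · intro T hzT hD hP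
    have d1 : disk k w₀ .Ri ⊆ T := hD 0
    have d2 : disk k w .Ri ⊆ T := hD 1
    have d3 : disk k (w.shift 1) .Ri ⊆ T := hD 2
    have d4 : disk k (w.shift 1) .Le ⊆ T := hD 3
    have d5 : disk k w .Le ⊆ T := hD 4
    have d6 : disk k w₀ .Le ⊆ T := hD 5
    have hD₀ : ∀ b, disk k w₀ b ⊆ T := fun b => by cases b <;> assumption
    have hDw : ∀ b, disk k w b ⊆ T := fun b => by cases b <;> assumption
    have hDw1 : ∀ b, disk k (w.shift 1) b ⊆ T := fun b => by cases b <;> assumption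
    have hside : ∀ b, SideBarrier k b w.x (w.y + ((level k).r + (level k).δ / 2)) T := by
      intro b
      cases b
      exacts [hP 3, hP 1]
    have hside₀ : ∀ b, SideBarrier k b w₀.x (w₀.y + ((level k).r + (level k).δ / 2)) T := by
      intro b
      cases b
      exacts [hP 4, hP 0]
    have hgap : GapBarrier k (w.shift 1) T := hP 2
    have hgap₀ : GapBarrier k w₀ T := hP 5
    refine separates_of_endBarriers (v := w₀) (v' := w.shift 1) hzw hzT hx₀ hx hDw
      (hgap₀.endBarrier hD₀ (Or.inr rfl) (by linarith))
      (hgap.endBarrier hDw1 (Or.inl rfl) (by linarith)) fun b => ?_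
    -- Here the abscissas `u` above and `u₀` below come from independent paths; the two lines are
    -- joined inside the disk of `w`.
    obtain ⟨u, hu, hcov⟩ := hs.extend (hside b) (hDw b) (hDw1 b)
    obtain ⟨u₀, hu₀, hcov₀⟩ := hext b T (hside₀ b) (hD₀ b) (hDw b)
    rw [hx₀] at hcov₀
    exact ⟨⟨u₀, hu₀, fun p hp h1 h2 => hcov₀ p hp h1 (by linarith)⟩,
      ⟨u, hu, fun p hp h1 h2 => hcov p hp (by linarith) h2⟩⟩

theorem hasSuccessor_of_lt {k : ℕ} (hk : 1 ≤ k) {w : Word} (hw : w ∈ wordsOfLength k)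
    (hn : w.n + 1 ≤ (level k).N) (hn' : k = 1 ∨ w.n ≠ (level k).N / 2) : HasSuccessor k w :=
  ⟨hw, shift_mem_wordsOfLength hk hw (by linarith [(one_le_n_le_N hk hw).1]) hn,
    shift_one_y hk hw hn'⟩

theorem proposition3p3 (z : ℂ) (hz : z ∈ cantorProduct) (k : ℕ) (hk : 1 ≤ k)
    (w : Word) (hw : w ∈ wordsOfLength k) (hzw : z ∈ rect k w) :
    ∃ Γ : Fin (neighbors k w).length → Set PlanePath,
      (∀ j, ∀ γ ∈ Γ j,
        γ.Connects ((neighbors k w).get j) ((neighbors k w).get (finRotate _ j)) OmegaFinite) ∧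
      (∀ j, 1 / 10 ≤ conformalModulus (Γ j)) ∧
      ∀ γ : Fin (neighbors k w).length → PlanePath, (∀ j, γ j ∈ Γ j) →
        Separates
          ((fun p : ℂ => (p : OnePoint ℂ)) '' ⋃ j, (γ j).trace ∪ (neighbors k w).get j)
          (z : OnePoint ℂ) OnePoint.infty := by
  change SeparatingFamilies z (neighbors k w)
  obtain ⟨hn1, hn2⟩ := one_le_n_le_N hk hw
  have hpred : 1 ≤ w.n - 1 → (k = 1 ∨ w.n - 1 ≠ (level k).N / 2) →
      HasSuccessor k (w.shift (-1)) := fun h h' =>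
    hasSuccessor_of_lt hk (shift_mem_wordsOfLength hk hw h (by linarith))
      (by simpa [Word.shift] using hn2) h'
  have hN : (k = 1 ∧ (level k).N = 2) ∨ (2 ≤ k ∧ ∃ M : ℤ, 100 ≤ M ∧ (level k).N = 2 * M) := by
    rcases hk.eq_or_lt with rfl | h
    exacts [Or.inl ⟨rfl, rfl⟩, Or.inr ⟨h, exists_level_N_eq h⟩]
  unfold neighbors
  split_ifs with h1 h2
  · obtain ⟨hb, ht⟩ := h1
    simp only [Word.IsBottom, Word.IsTop, not_or] at hb ht
    -- Not being a bottom means that no parent gap lies between `w - 1` and `w`; not being a top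
    -- means the same for `w` and `w + 1`.
    exact separatingFamilies_middle hk (hpred (by omega) (Or.inr (by omega)))
      Word.shift_neg_one_shift_one (hasSuccessor_of_lt hk hw (by omega) (Or.inr ht.1)) hz hzw
  · obtain ⟨hb, ht⟩ := h2
    simp only [Word.IsBottom] at hb
    refine separatingFamilies_bottom hk (hasSuccessor_of_lt hk hw ht ?_)
      (fun v hv => clear_beyond_end hk hw .Ri ?_ hv) hz hzw
    · rcases hN with ⟨h, -⟩ | ⟨-, M, hM, h⟩
      · exact Or.inl h
      · exact Or.inr (by omega)
    · simp only [Side.sign, one_mul, sub_nonneg, Int.cast_le]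
      rcases hN with ⟨h, h'⟩ | ⟨h, M, hM, h'⟩
      · exact Or.inl ⟨h, fun n _ _ => by omega⟩
      · exact Or.inr ⟨h, fun n _ _ _ => by omega⟩
  · simp only [Word.IsBottom, Word.IsTop] at h1 h2
    refine separatingFamilies_top hk (hpred ?_ ?_) Word.shift_neg_one_shift_one
      (fun v hv => clear_beyond_end hk hw .Le ?_ hv) hz hzw
    -- This case contains the tops and, for `k = 1`, the letter 2, which is also a bottom. On higher
    -- levels `M ≥ 100` rules out a bottom that is the last letter.
    · rcases hN with ⟨-, h⟩ | ⟨-, M, hM, h⟩ <;> omega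
    · rcases hN with ⟨h, -⟩ | ⟨-, M, hM, h⟩
      · exact Or.inl h
      · exact Or.inr (by omega)
    · have hsign : ∀ n : ℤ, 0 ≤ Side.Le.sign * ((n : ℝ) - w.n) ↔ n ≤ w.n := fun n => by
        rw [← Int.cast_le (R := ℝ), Side.sign]
        constructor <;> intro h <;> linarith
      simp only [hsign]
      rcases hN with ⟨h, h'⟩ | ⟨h, M, hM, h'⟩
      · exact Or.inl ⟨h, fun n _ _ => by omega⟩
      · exact Or.inr ⟨h, fun n _ _ _ => by omega⟩
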